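/- Let $(K,\mathcal O,k)$ be a $2$-modular system with $K$ complete and $k$ algebraically closed; that is, $\mathcal O$ is a complete discrete valuation ring of characteristic $0$ with field of fractions $K$ and algebraically closed residue field $k$ of characteristic $2$. Let $n\ge 3$, $c=2^{n-2}$ and $l=2^{n-2}-1$. Let $\bar\Lambda=Q(3\mathcal K)^c=kQ/I$, where $Q$ is the quiver with vertices $1,2,3$ and arrows $\beta:1\to2$, $\gamma:2\to1$, $\delta:2\to3$, $\eta:3\to2$, $\kappa:1\to3$, $\lambda:3\to1$ (paths are composed from left to right), and $I$ is the ideal generated by the relations $$\beta\delta=\kappa\lambda\kappa,\quad \eta\gamma=\lambda\kappa\lambda,\quad \delta\lambda=\gamma\beta\gamma,\quad \kappa\eta=\beta\gamma\beta,\quad \lambda\beta=(\eta\delta)^{c-1}\eta,\quad \gamma\kappa=(\delta\eta)^{c-1}\delta,$$ $$\gamma\beta\delta=0,\quad \delta\eta\gamma=0,\quad \lambda\kappa\eta=0 .$$ Let $$A = K\oplus K \oplus K \oplus K^{3\times 3} \oplus K^{2\times 2} \oplus K^{2\times 2} \oplus \bigoplus_{i=7}^{6+l} K^{2\times 2},$$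 and let $D$ be the $(6+l)\times 3$ matrix with rows $$(1,0,0),\ (0,1,0),\ (0,0,1),\ (1,1,1),\ (1,1,0),\ (1,0,1),\ \underbrace{(0,1,1),\dots,(0,1,1)}_{l}.$$ An $\mathcal O$-order in $A$ is an $\mathcal O$-subalgebra of $A$ that is finitely generated as an $\mathcal O$-module and spans $A$ over $K$. An order $\Lambda$ is symmetric if there is an $\mathcal O$-linear map $t:\Lambda\to\mathcal O$ with $t(xy)=t(yx)$ such that $x\mapsto t(x\,\cdot\,)$ is a bijection $\Lambda\to\operatorname{Hom}_{\mathcal O}(\Lambda,\mathcal O)$. An order $\Lambda$ in $A$ has decomposition matrix $D$ if the isomorphism classes of projective indecomposable $\Lambda$-modules can be labelled $P_1,P_2,P_3$ such that for each $j$ and each $i$ the simple module of the $i$-th component of $A$ (in the order written above) occurs in $K\otimes_{\mathcal O} P_j$ with multiplicity $D_{ij}$. Let $\Lambda,\Gamma\subset A$ be two $\mathcal O$-orders such that 1. $k\otimes_{\mathcal O}\Lambda\cong k\otimes_{\mathcal O}\Gamma\cong\bar\Lambda$ as $k$-algebras; 2. $\Lambda$ and $\Gamma$ are symmetric; 3.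 $\Lambda$ and $\Gamma$ both have decomposition matrix $D$; 4. $Z(\Lambda)=Z(\Gamma)$ as subsets of $A$. Then $\Lambda$ and $\Gamma$ are conjugate in $A$: there is a unit $u\in A^\times$ with $\Gamma=u\Lambda u^{-1}$. -/

import Mathlib

open scoped TensorProduct

/-! ### The algebra `Q(3K)^c` with parameters `a = b = 2` -/

namespace Q3K

/-- Generators of the quiver algebra: the trivial paths `e 0`, `e 1`, `e 2` at the three vertices
(the vertices `1, 2, 3` of the usual picture) and the six arrows
`β : 1 → 2`, `γ : 2 → 1`, `δ : 2 → 3`, `η : 3 → 2`, `κ : 1 → 3`, `lam : 3 → 1`. -/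
inductive Gen : Type
  | e (v : Fin 3)
  | β
  | γ
  | δ
  | η
  | κ
  | lam

/-- A generator, seen in the free algebra on all generators. -/
def gen (k : Type*) [CommRing k] (g : Gen) : FreeAlgebra k Gen := FreeAlgebra.ι k g

/-- The relations of `kQ / I`. The constructors `idem` to `lam_path` present the path algebra `kQ`:
the `e v` are orthogonal idempotents with sum `1`, and an arrow from `u` to `v` is
fixed by `e u` on the left and by `e v` on the right (paths are composed from left to right).
The remaining constructors are the generators of the ideal `I`. -/
inductive Rel (k : Type*) [CommRing k] (c : ℕ) : FreeAlgebra k Gen → FreeAlgebra k Gen → Prop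
  | idem (v : Fin 3) : Rel k c (gen k (.e v) * gen k (.e v)) (gen k (.e v))
  | orth (u v : Fin 3) (h : u ≠ v) : Rel k c (gen k (.e u) * gen k (.e v)) 0
  | sum_one : Rel k c (gen k (.e 0) + gen k (.e 1) + gen k (.e 2)) 1
  | β_path : Rel k c (gen k (.e 0) * gen k .β * gen k (.e 1)) (gen k .β)
  | γ_path : Rel k c (gen k (.e 1) * gen k .γ * gen k (.e 0)) (gen k .γ)
  | δ_path : Rel k c (gen k (.e 1) * gen k .δ * gen k (.e 2)) (gen k .δ)
  | η_path : Rel k c (gen k (.e 2) * gen k .η * gen k (.e 1)) (gen k .η)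
  | κ_path : Rel k c (gen k (.e 0) * gen k .κ * gen k (.e 2)) (gen k .κ)
  | lam_path : Rel k c (gen k (.e 2) * gen k .lam * gen k (.e 0)) (gen k .lam)
  | βδ : Rel k c (gen k .β * gen k .δ) (gen k .κ * gen k .lam * gen k .κ)
  | ηγ : Rel k c (gen k .η * gen k .γ) (gen k .lam * gen k .κ * gen k .lam)
  | δlam : Rel k c (gen k .δ * gen k .lam) (gen k .γ * gen k .β * gen k .γ)
  | κη : Rel k c (gen k .κ * gen k .η) (gen k .β * gen k .γ * gen k .β)
  | lamβ : Rel k c (gen k .lam * gen k .β) ((gen k .η * gen k .δ) ^ (c - 1) * gen k .η)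
  | γκ : Rel k c (gen k .γ * gen k .κ) ((gen k .δ * gen k .η) ^ (c - 1) * gen k .δ)
  | γβδ : Rel k c (gen k .γ * gen k .β * gen k .δ) 0
  | δηγ : Rel k c (gen k .δ * gen k .η * gen k .γ) 0
  | lamκη : Rel k c (gen k .lam * gen k .κ * gen k .η) 0

end Q3K

/-- The `k`-algebra `Q(3K)^c = kQ / I` (with `a = b = 2`), by generators and relations. -/
abbrev Q3K (k : Type*) [CommRing k] (c : ℕ) : Type _ := RingQuot (Q3K.Rel k c)

/-! ### Symmetric algebras -/

/-- An `R`-algebra `S`, finitely generated and projective as an `R`-module, is symmetric if it has a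
symmetrizing form: an `R`-linear `t : S → R` with `t (x * y) = t (y * x)`
for which `x ↦ t (x * ·)` is a bijection from `S` onto `Hom_R(S, R)`. -/
def IsSymmetricAlg (R S : Type*) [CommRing R] [Ring S] [Algebra R S] : Prop :=
  Module.Finite R S ∧ Module.Projective R S ∧
    ∃ t : S →ₗ[R] R, (∀ x y : S, t (x * y) = t (y * x)) ∧
      Function.Bijective (fun x : S ↦ (t ∘ₗ LinearMap.mulLeft R x : S →ₗ[R] R))

/-! ### Split semisimple algebras and decomposition matrices of orders in them -/

/-- The split semisimple algebra `⨁ i, K^{d i × d i}`. -/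
abbrev MatrixProd (K : Type*) {ι : Type*} (d : ι → ℕ) : Type _ :=
  ∀ i, Matrix (Fin (d i)) (Fin (d i)) K

/-- The simple module `K^{d i}` (column vectors) of the `i`-th component of `⨁ i, K^{d i × d i}`. -/
def ColumnModule (K : Type*) {ι : Type*} (d : ι → ℕ) (i : ι) : Type _ := Fin (d i) → K

namespace ColumnModule

variable {K : Type*} [Field K] {ι : Type*} (d : ι → ℕ) (i : ι)

instance : AddCommGroup (ColumnModule K d i) := inferInstanceAs (AddCommGroup (Fin (d i) → K))

/-- `⨁ i, K^{d i × d i}` acts on `K^{d i}` through its `i`-th component. -/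
instance : Module (MatrixProd K d) (ColumnModule K d i) where
  smul a v := (a i).mulVec v
  one_smul v := Matrix.one_mulVec v
  mul_smul a b v := (Matrix.mulVec_mulVec v (a i) (b i)).symm
  smul_zero a := Matrix.mulVec_zero (a i)
  smul_add a v w := Matrix.mulVec_add (a i) v w
  add_smul a b v := Matrix.add_mulVec (a i) (b i) v
  zero_smul v := Matrix.zero_mulVec v

end ColumnModule

/-- A primitive idempotent: a nonzero idempotent `e` such that `0` and `e` are the only
idempotents `f` with `e * f = f = f * e`. -/
def IsPrimitiveIdempotent {S : Type*} [Ring S] (e : S) : Prop :=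
  IsIdempotentElem e ∧ e ≠ 0 ∧
    ∀ f : S, IsIdempotentElem f → e * f = f → f * e = f → f = 0 ∨ f = e

/-- `D` is the decomposition matrix of the order `Λ` in `A = ⨁ i, K^{d i × d i}`.
The rows are indexed by the components of `A`; the columns belong to the projective
indecomposable `Λ`-modules `P j = Λ e j`, with `e j` primitive idempotents of `Λ` which represent
each isomorphism class of projective indecomposables exactly once. The entries are given by
`K ⊗ P j = A e j ≅ ⨁ i, (K^{d i})^{D i j}`. So the order of the rows is fixed by the inclusion of
`Λ` into `A`, and there is some labelling of the projective indecomposables by the columns. -/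
def HasDecompositionMatrix {O K : Type*} [CommRing O] [Field K] [Algebra O K]
    {ι J : Type*} (d : ι → ℕ) (Λ : Subalgebra O (MatrixProd K d)) (D : Matrix ι J ℕ) : Prop :=
  ∃ e : J → Λ,
    (∀ j, IsPrimitiveIdempotent (e j)) ∧
    (∀ j j', Nonempty (Ideal.span {e j} ≃ₗ[Λ] Ideal.span {e j'}) → j = j') ∧
    (∀ f : Λ, IsPrimitiveIdempotent f → ∃ j, Nonempty (Ideal.span {f} ≃ₗ[Λ] Ideal.span {e j})) ∧
    ∀ j, Nonempty (Ideal.span {(e j : MatrixProd K d)} ≃ₗ[MatrixProd K d]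
      (∀ i, Fin (D i j) → ColumnModule K d i))

/-! ### The particular algebra and matrix -/

/-- The sizes `1, 1, 1, 3, 2, 2, 2, …, 2` of the matrix rings in
`A = K ⊕ K ⊕ K ⊕ K^{3×3} ⊕ K^{2×2} ⊕ K^{2×2} ⊕ ⨁_{r = 1}^{l} K^{2×2}` (indices start at `0`). -/
def componentSize : ℕ → ℕ
  | 0 => 1
  | 1 => 1
  | 2 => 1
  | 3 => 3
  | _ => 2

/-- The sizes as a family indexed by the `6 + l` components, `l = 2^(n-2) - 1`. -/
def sizes (n : ℕ) (i : Fin (6 + (2 ^ (n - 2) - 1))) : ℕ := componentSize i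

/-- The rows of the decomposition matrix; all rows from the seventh on are `(0, 1, 1)`. -/
def decompositionRow : ℕ → Fin 3 → ℕ
  | 0 => ![1, 0, 0]
  | 1 => ![0, 1, 0]
  | 2 => ![0, 0, 1]
  | 3 => ![1, 1, 1]
  | 4 => ![1, 1, 0]
  | 5 => ![1, 0, 1]
  | _ => ![0, 1, 1]

/-- The `(6 + l) × 3` decomposition matrix, `l = 2^(n-2) - 1`. -/
def decompositionMatrix (n : ℕ) : Matrix (Fin (6 + (2 ^ (n - 2) - 1))) (Fin 3) ℕ :=
  Matrix.of fun i ↦ decompositionRow i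

/-! Number the vertices 0, 1, 2. In `Q3K` the sum of the two 2-cycles along an edge is central, and
the relations turn a product of two arrows along two sides of the triangle into a central multiple
of the third side. So every Peirce component is generated by a single arrow over a commutative
central subalgebra (`exists_idem_mul_mul_idem_eq`), whose elements are scalar plus nilpotent.

This structure lifts to a symmetric order Λ. Modulo commutators the algebra is spanned by c + 5
elements (`classSpan_eq_top`), and c + 5 = 6 + l is the number of simple components of A, hence of
irreducible characters. Therefore Λ/[Λ,Λ] is free of that rank. For a symmetric order the centre is
the dual of this quotient, so central elements lift (`exists_center_lift`), and by Nakayama the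
Peirce components of Λ are cyclic over Z(Λ) (`exists_peirceSystem`).

As D has entries 0 and 1, the (j, j') Peirce component of A is a product of copies of K, one for
each i with D i j = D i j' = 1. So Λ is described by its centre, seen in K^ι, and vectors ξ j j'
that generate the components (`exists_peirceData`). A diagonal unit rescales these vectors. If two
orders have the same centre, their symmetrizing forms differ by a central factor on each idempotent.
Opposite components are dual to each other, so it is enough to match the components (0,1), (1,2) and
(0,2). The only obstruction is the ratio ξ 0 1 * ξ 1 2 / ξ 0 2 at the one row (1,1,1). The product
of two consecutive generators is not divisible by the uniformizer, which forces the ratios of the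
two orders to differ by a unit of O (`exists_unit`). Such a unit does not change the module
generated by a vector, so the rescaling exists (`exists_rescaling`). -/

namespace Q3K

/-! ### The quiver algebra: vanishing paths and central sums of 2-cycles. -/

/-- The generator spanning the arrows from `u` to `v`, or the trivial path if `u = v`. -/
def arrowGen : Fin 3 → Fin 3 → Gen :=
  ![![.e 0, .β, .κ], ![.γ, .e 1, .δ], ![.lam, .η, .e 2]]

lemma exists_arrowGen (g : Gen) : ∃ u v, g = arrowGen u v := by
  cases g with
  | e v => exact ⟨v, v, by fin_cases v <;> rfl⟩
  | β => exact ⟨0, 1, rfl⟩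
  | γ => exact ⟨1, 0, rfl⟩
  | δ => exact ⟨1, 2, rfl⟩
  | η => exact ⟨2, 1, rfl⟩
  | κ => exact ⟨0, 2, rfl⟩
  | lam => exact ⟨2, 0, rfl⟩

variable (k : Type*) [CommRing k] (c : ℕ)

/-- The image in `Q3K k c` of the arrow from `u` to `v` (of the trivial path if `u = v`). -/
noncomputable def arrow (u v : Fin 3) : Q3K k c :=
  RingQuot.mkAlgHom k (Rel k c) (gen k (arrowGen u v))

variable {k c}

lemma mkAlgHom_eq {x y : FreeAlgebra k Gen} (h : Rel k c x y) :
    RingQuot.mkAlgHom k (Rel k c) x = RingQuot.mkAlgHom k (Rel k c) y :=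
  RingQuot.mkAlgHom_rel k h

local notation "a" => arrow k c

lemma idem_mul_idem (v : Fin 3) : a v v * a v v = a v v := by
  have := mkAlgHom_eq (c := c) (Rel.idem (k := k) v)
  simp only [map_mul] at this
  fin_cases v <;> exact this

lemma idem_mul_idem_of_ne {u v : Fin 3} (h : u ≠ v) : a u u * a v v = 0 := by
  have := mkAlgHom_eq (c := c) (Rel.orth (k := k) u v h)
  simp only [map_mul, map_zero] at this
  fin_cases u <;> fin_cases v <;> first | exact absurd rfl h | exact this

lemma idem_sum : a 0 0 + a 1 1 + a 2 2 = 1 := by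
  have h := mkAlgHom_eq (c := c) (Rel.sum_one (k := k))
  simp only [map_add, map_one] at h
  exact h

lemma idem_mul_arrow_mul_idem (u v : Fin 3) : a u u * a u v * a v v = a u v := by
  by_cases h : u = v
  · subst h; rw [idem_mul_idem, idem_mul_idem]
  have h1 := mkAlgHom_eq (c := c) (Rel.β_path (k := k))
  have h2 := mkAlgHom_eq (c := c) (Rel.γ_path (k := k))
  have h3 := mkAlgHom_eq (c := c) (Rel.δ_path (k := k))
  have h4 := mkAlgHom_eq (c := c) (Rel.η_path (k := k))
  have h5 := mkAlgHom_eq (c := c) (Rel.κ_path (k := k))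
  have h6 := mkAlgHom_eq (c := c) (Rel.lam_path (k := k))
  simp only [map_mul] at h1 h2 h3 h4 h5 h6
  fin_cases u <;> fin_cases v <;> first | exact absurd rfl h | assumption

lemma idem_mul_arrow (u v : Fin 3) : a u u * a u v = a u v := by
  rw [← idem_mul_arrow_mul_idem u v, ← mul_assoc, ← mul_assoc, idem_mul_idem]

lemma arrow_mul_idem (u v : Fin 3) : a u v * a v v = a u v := by
  rw [← idem_mul_arrow_mul_idem u v, mul_assoc, idem_mul_idem]

lemma arrow_mul_arrow_of_ne {u v v' w : Fin 3} (h : v ≠ v') : a u v * a v' w = 0 := by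
  rw [← arrow_mul_idem u v, ← idem_mul_arrow v' w, mul_assoc, ← mul_assoc (a v v),
    idem_mul_idem_of_ne h, zero_mul, mul_zero]

lemma arrow_mul_arrow_mul_of_ne {u v v' w : Fin 3} (h : v ≠ v') (x : Q3K k c) :
    a u v * (a v' w * x) = 0 := by
  rw [← mul_assoc, arrow_mul_arrow_of_ne h, zero_mul]

lemma β_δ : a 0 1 * a 1 2 = a 0 2 * a 2 0 * a 0 2 := by
  have h := mkAlgHom_eq (c := c) (Rel.βδ (k := k))
  simp only [map_mul] at h
  exact h
lemma η_γ : a 2 1 * a 1 0 = a 2 0 * a 0 2 * a 2 0 := by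
  have h := mkAlgHom_eq (c := c) (Rel.ηγ (k := k))
  simp only [map_mul] at h
  exact h
lemma δ_lam : a 1 2 * a 2 0 = a 1 0 * a 0 1 * a 1 0 := by
  have h := mkAlgHom_eq (c := c) (Rel.δlam (k := k))
  simp only [map_mul] at h
  exact h
lemma κ_η : a 0 2 * a 2 1 = a 0 1 * a 1 0 * a 0 1 := by
  have h := mkAlgHom_eq (c := c) (Rel.κη (k := k))
  simp only [map_mul] at h
  exact h
lemma lam_β : a 2 0 * a 0 1 = (a 2 1 * a 1 2) ^ (c - 1) * a 2 1 := by
  have h := mkAlgHom_eq (c := c) (Rel.lamβ (k := k))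
  simp only [map_mul, map_pow] at h
  exact h
lemma γ_κ : a 1 0 * a 0 2 = (a 1 2 * a 2 1) ^ (c - 1) * a 1 2 := by
  have h := mkAlgHom_eq (c := c) (Rel.γκ (k := k))
  simp only [map_mul, map_pow] at h
  exact h
lemma γ_β_δ : a 1 0 * a 0 1 * a 1 2 = 0 := by
  have h := mkAlgHom_eq (c := c) (Rel.γβδ (k := k))
  simp only [map_mul, map_zero] at h
  exact h
lemma δ_η_γ : a 1 2 * a 2 1 * a 1 0 = 0 := by
  have h := mkAlgHom_eq (c := c) (Rel.δηγ (k := k))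
  simp only [map_mul, map_zero] at h
  exact h
lemma lam_κ_η : a 2 0 * a 0 2 * a 2 1 = 0 := by
  have h := mkAlgHom_eq (c := c) (Rel.lamκη (k := k))
  simp only [map_mul, map_zero] at h
  exact h

/-- Twelve paths run back and forth along one edge and then leave it, or enter it from the third
vertex first. Three of them are zero by definition; this lemma and the next eight deduce the others
by substituting a relation that exposes a path already known to vanish. -/
lemma β_δ_η : a 0 1 * a 1 2 * a 2 1 = 0 := by
  rw [β_δ, mul_assoc, mul_assoc, ← mul_assoc (a 2 0), lam_κ_η, mul_zero]
lemma κ_η_δ : a 0 2 * a 2 1 * a 1 2 = 0 := by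
  rw [κ_η, mul_assoc, mul_assoc, ← mul_assoc (a 1 0), γ_β_δ, mul_zero]

section
variable (hc : 2 ≤ c)
include hc

lemma β_γ_κ : a 0 1 * a 1 0 * a 0 2 = 0 := by
  -- Here `2 ≤ c` matters: the exponent `c - 1` is positive, so one full 2-cycle can be split off
  -- and meets the preceding arrow.
  rw [mul_assoc, γ_κ, show c - 1 = (c - 2) + 1 by omega, pow_succ']
  simp only [← mul_assoc, β_δ_η, zero_mul]
lemma κ_lam_β : a 0 2 * a 2 0 * a 0 1 = 0 := by
  rw [mul_assoc, lam_β, show c - 1 = (c - 2) + 1 by omega, pow_succ']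
  simp only [← mul_assoc, κ_η_δ, zero_mul]
lemma lam_β_γ : a 2 0 * a 0 1 * a 1 0 = 0 := by
  rw [lam_β, show c - 1 = (c - 2) + 1 by omega, pow_succ]
  rw [mul_assoc, mul_assoc, mul_assoc, ← mul_assoc (a 1 2), δ_η_γ, mul_zero, mul_zero]
lemma η_γ_β : a 2 1 * a 1 0 * a 0 1 = 0 := by
  rw [η_γ, mul_assoc, mul_assoc, ← mul_assoc (a 0 2), κ_lam_β hc, mul_zero]
lemma η_δ_lam : a 2 1 * a 1 2 * a 2 0 = 0 := by
  rw [mul_assoc, δ_lam, ← mul_assoc, ← mul_assoc, η_γ_β hc, zero_mul]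
lemma γ_κ_lam : a 1 0 * a 0 2 * a 2 0 = 0 := by
  rw [γ_κ, show c - 1 = (c - 2) + 1 by omega, pow_succ]
  rw [mul_assoc, mul_assoc, mul_assoc, ← mul_assoc (a 2 1), η_δ_lam hc, mul_zero, mul_zero]
lemma δ_lam_κ : a 1 2 * a 2 0 * a 0 2 = 0 := by
  rw [δ_lam, mul_assoc, mul_assoc, ← mul_assoc (a 0 1), β_γ_κ hc, mul_zero]

end

variable (k c) in
/-- The sum of the two cycles of length two through `u` and `v`. -/
noncomputable def cyc (u v : Fin 3) : Q3K k c := a u v * a v u + a v u * a u v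

local notation "z" => cyc k c

lemma cyc_comm (u v : Fin 3) : z u v = z v u := add_comm _ _

lemma cyc_mul_idem_left {u v : Fin 3} (h : u ≠ v) : z u v * a u u = a u v * a v u := by
  rw [cyc, add_mul, mul_assoc, mul_assoc, arrow_mul_idem, arrow_mul_arrow_of_ne h.symm]; simp

lemma cyc_mul_idem_right {u v : Fin 3} (h : u ≠ v) : z u v * a v v = a v u * a u v := by
  rw [cyc_comm, cyc_mul_idem_left h.symm]

lemma cyc_mul_arrow_of_ne {u v w x : Fin 3} (hu : w ≠ u) (hv : w ≠ v) : z u v * a w x = 0 := by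
  rw [cyc, add_mul, mul_assoc, mul_assoc, arrow_mul_arrow_of_ne hu.symm,
    arrow_mul_arrow_of_ne hv.symm]; simp

/-- A path which runs back and forth along one edge and leaves it for the third vertex is zero. -/
lemma arrow_mul_arrow_back_mul_arrow (hc : 2 ≤ c) {u v w : Fin 3} (h : u ≠ v) (hu : w ≠ u)
    (hv : w ≠ v) : a u v * a v u * a u w = 0 := by
  have := β_γ_κ (k := k) hc
  have := κ_lam_β (k := k) hc
  have := η_δ_lam (k := k) hc
  have := γ_β_δ (k := k) (c := c)
  have := δ_η_γ (k := k) (c := c)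
  have := lam_κ_η (k := k) (c := c)
  fin_cases u <;> fin_cases v <;> fin_cases w <;>
    first | exact absurd rfl h | exact absurd rfl hu | exact absurd rfl hv | assumption

/-- A path which comes from the third vertex and runs back and forth along an edge is zero. -/
lemma arrow_mul_arrow_mul_arrow_back (hc : 2 ≤ c) {u v w : Fin 3} (h : u ≠ v) (hu : w ≠ u)
    (hv : w ≠ v) : a w u * a u v * a v u = 0 := by
  have := β_δ_η (k := k) (c := c)
  have := κ_η_δ (k := k) (c := c)
  have := lam_β_γ (k := k) hc
  have := η_γ_β (k := k) hc
  have := γ_κ_lam (k := k) hc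
  have := δ_lam_κ (k := k) hc
  fin_cases u <;> fin_cases v <;> fin_cases w <;>
    first | exact absurd rfl h | exact absurd rfl hu | exact absurd rfl hv | assumption

/-- Along the edge itself both sides are the same path of length three. For an arrow with exactly
one end on the edge, both products vanish, either because the ends do not match or because the path
leaves or enters the edge. At a vertex both sides are the 2-cycle there, or zero. -/
lemma cyc_mul_arrow (hc : 2 ≤ c) {u v : Fin 3} (h : u ≠ v) (x y : Fin 3) :
    z u v * a x y = a x y * z u v := by
  wlog hx : x ≠ v generalizing u v
  · rw [cyc_comm]
    exact this h.symm (by rw [not_not.1 hx]; exact h.symm)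
  by_cases hxu : x = u
  · subst hxu
    by_cases hyx : y = x
    · subst hyx
      rw [cyc_mul_idem_left h, cyc, mul_add, ← mul_assoc, idem_mul_arrow,
        ← mul_assoc, arrow_mul_arrow_of_ne h, zero_mul, add_zero]
    by_cases hyv : y = v
    · subst hyv
      rw [cyc, add_mul, mul_add, mul_assoc (a y x), arrow_mul_arrow_of_ne h.symm, ← mul_assoc (a x y),
        arrow_mul_arrow_of_ne h.symm]
      simp [mul_assoc]
    · rw [cyc, add_mul, arrow_mul_arrow_back_mul_arrow hc h hyx hyv, mul_add, ← mul_assoc,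
        arrow_mul_arrow_of_ne hyx, ← mul_assoc, arrow_mul_arrow_of_ne hyv, mul_assoc,
        arrow_mul_arrow_of_ne h.symm]
      simp
  · rw [cyc_mul_arrow_of_ne hxu hx]
    by_cases hyu : y = u
    · subst hyu
      rw [cyc, mul_add, ← mul_assoc, arrow_mul_arrow_mul_arrow_back hc h hxu hx, ← mul_assoc,
        arrow_mul_arrow_of_ne h]
      simp
    by_cases hyv : y = v
    · subst hyv
      rw [cyc, mul_add, ← mul_assoc, ← mul_assoc, arrow_mul_arrow_mul_arrow_back hc h.symm hx hxu,
        arrow_mul_arrow_of_ne h.symm]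
      simp
    · rw [cyc, mul_add, ← mul_assoc, ← mul_assoc, arrow_mul_arrow_of_ne hyu,
        arrow_mul_arrow_of_ne hyv]
      simp

/-- Induction principle: a subalgebra which contains all arrows is everything. -/
lemma subalgebra_eq_top (S : Subalgebra k (Q3K k c)) (h : ∀ u v, a u v ∈ S) : S = ⊤ := by
  rw [eq_top_iff]
  rintro b -
  obtain ⟨x, rfl⟩ := RingQuot.mkAlgHom_surjective k (Rel k c) b
  induction x using FreeAlgebra.induction with
  | grade0 r => rw [AlgHom.commutes]; exact S.algebraMap_mem r
  | grade1 g =>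
    obtain ⟨u, v, rfl⟩ := exists_arrowGen g
    exact h u v
  | mul x y hx hy => rw [map_mul]; exact S.mul_mem hx hy
  | add x y hx hy => rw [map_add]; exact S.add_mem hx hy

lemma mem_center_of_commute {x : Q3K k c} (h : ∀ u v, x * a u v = a u v * x) :
    x ∈ Subalgebra.center k (Q3K k c) := by
  rw [Subalgebra.mem_center_iff]
  have : Subalgebra.centralizer k {x} = ⊤ := by
    refine subalgebra_eq_top _ fun u v ↦ ?_
    rw [Subalgebra.mem_centralizer_iff]
    rintro _ rfl
    exact h u v
  intro b
  have hb : b ∈ Subalgebra.centralizer k {x} := this ▸ Algebra.mem_top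
  exact ((Subalgebra.mem_centralizer_iff k).1 hb x rfl).symm

lemma cyc_mem_center (hc : 2 ≤ c) {u v : Fin 3} (h : u ≠ v) :
    z u v ∈ Subalgebra.center k (Q3K k c) :=
  mem_center_of_commute (cyc_mul_arrow hc h)

end Q3K

/-! ### Peirce components over the central subalgebra of cycles; nilpotency. -/

namespace Q3K

variable {k : Type*} [CommRing k] {c : ℕ}

local notation "a" => arrow k c
local notation "z" => cyc k c

variable (k c) in
/-- The central subalgebra generated by the sums of cycles. -/
noncomputable def cycAlgebra : Subalgebra k (Q3K k c) := Algebra.adjoin k {z 0 1, z 0 2, z 1 2}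

lemma cyc_mem_cycAlgebra {u v : Fin 3} (h : u ≠ v) : z u v ∈ cycAlgebra k c := by
  have h01 : z 0 1 ∈ cycAlgebra k c := Algebra.subset_adjoin (by simp)
  have h02 : z 0 2 ∈ cycAlgebra k c := Algebra.subset_adjoin (by simp)
  have h12 : z 1 2 ∈ cycAlgebra k c := Algebra.subset_adjoin (by simp)
  fin_cases u <;> fin_cases v <;>
    first | exact absurd rfl h | assumption | (rw [cyc_comm]; assumption)

lemma cycAlgebra_le_center (hc : 2 ≤ c) : cycAlgebra k c ≤ Subalgebra.center k (Q3K k c) := by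
  rw [cycAlgebra, Algebra.adjoin_le_iff]
  rintro _ (rfl | rfl | rfl) <;> exact cyc_mem_center hc (by decide)

lemma cycAlgebra_comm (hc : 2 ≤ c) {x : Q3K k c} (hx : x ∈ cycAlgebra k c) (b : Q3K k c) :
    b * x = x * b :=
  Subalgebra.mem_center_iff.1 (cycAlgebra_le_center hc hx) b

lemma cyc_mul_comm (hc : 2 ≤ c) {u v : Fin 3} (h : u ≠ v) (b : Q3K k c) : b * z u v = z u v * b :=
  cycAlgebra_comm hc (cyc_mem_cycAlgebra h) b

lemma eq_zero_of_mul_idem {x : Q3K k c} (h : ∀ v, x * a v v = 0) : x = 0 := by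
  rw [← mul_one x, ← idem_sum, mul_add, mul_add, h, h, h]; simp

lemma cyc_mul_cyc (hc : 2 ≤ c) {u v w : Fin 3} (h : u ≠ v) (hu : w ≠ u) (hv : w ≠ v) :
    z u v * z u w = 0 := by
  have h0 : a u v * (a v u * (a u w * a w u)) = 0 := by
    rw [← mul_assoc, ← mul_assoc, arrow_mul_arrow_back_mul_arrow hc h hu hv, zero_mul]
  simp only [cyc, mul_add, add_mul, mul_assoc, h0, arrow_mul_arrow_mul_of_ne hu.symm,
    arrow_mul_arrow_mul_of_ne h.symm,
    arrow_mul_arrow_mul_of_ne hv.symm, mul_zero, add_zero]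

lemma cyc_zero_one_mul_cyc_zero_two (hc : 2 ≤ c) : z 0 1 * z 0 2 = 0 :=
  cyc_mul_cyc hc (by decide) (by decide) (by decide)

lemma cyc_zero_one_mul_cyc_one_two (hc : 2 ≤ c) : z 0 1 * z 1 2 = 0 := by
  rw [cyc_comm 0 1]; exact cyc_mul_cyc hc (by decide) (by decide) (by decide)

lemma cyc_zero_two_mul_cyc_one_two (hc : 2 ≤ c) : z 0 2 * z 1 2 = 0 := by
  rw [cyc_comm 0 2, cyc_comm 1 2]; exact cyc_mul_cyc hc (by decide) (by decide) (by decide)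

/-- Central form of the defining relations: the 2-cycles on the right-hand side are absorbed into a
central factor, leaving one arrow. This and the five analogous identities make the Peirce components
cyclic. -/
lemma β_δ_eq : a 0 1 * a 1 2 = z 0 2 * a 0 2 := by
  rw [β_δ, ← cyc_mul_idem_left (by decide), mul_assoc, idem_mul_arrow]
lemma η_γ_eq : a 2 1 * a 1 0 = z 0 2 * a 2 0 := by
  rw [η_γ, ← cyc_mul_idem_right (by decide), mul_assoc, idem_mul_arrow]
lemma δ_lam_eq : a 1 2 * a 2 0 = z 0 1 * a 1 0 := by
  rw [δ_lam, ← cyc_mul_idem_right (by decide), mul_assoc, idem_mul_arrow]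
lemma κ_η_eq : a 0 2 * a 2 1 = z 0 1 * a 0 1 := by
  rw [κ_η, ← cyc_mul_idem_left (by decide), mul_assoc, idem_mul_arrow]

lemma cycle_pow_mul_arrow (hc : 2 ≤ c) {u v : Fin 3} (h : u ≠ v) (m : ℕ) :
    (a u v * a v u) ^ m * a u v = z u v ^ m * a u v := by
  induction m with
  | zero => simp
  | succ m ih =>
    have h0 : a u v * a v u * a u v = a u v * z u v := by
      rw [← cyc_mul_idem_left h, mul_assoc, idem_mul_arrow, cyc_mul_comm hc h]
    rw [pow_succ, mul_assoc, h0, ← mul_assoc, ih, mul_assoc, cyc_mul_comm hc h, ← mul_assoc,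
      pow_succ]

lemma lam_β_eq (hc : 2 ≤ c) : a 2 0 * a 0 1 = z 1 2 ^ (c - 1) * a 2 1 := by
  rw [lam_β, cycle_pow_mul_arrow hc (by decide), cyc_comm]
lemma γ_κ_eq (hc : 2 ≤ c) : a 1 0 * a 0 2 = z 1 2 ^ (c - 1) * a 1 2 := by
  rw [γ_κ, cycle_pow_mul_arrow hc (by decide)]

lemma exists_mul_eq (hc : 2 ≤ c) (u v w : Fin 3) :
    ∃ x ∈ cycAlgebra k c, a u v * a v w = x * a u w := by
  by_cases huv : u = v
  · subst huv; exact ⟨1, one_mem _, by rw [idem_mul_arrow, one_mul]⟩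
  by_cases hvw : v = w
  · subst hvw; exact ⟨1, one_mem _, by rw [arrow_mul_idem, one_mul]⟩
  by_cases huw : u = w
  · subst huw; exact ⟨z u v, cyc_mem_cycAlgebra huv, by rw [cyc_mul_idem_left huv]⟩
  have h01 := cyc_mem_cycAlgebra (k := k) (c := c) (show (0 : Fin 3) ≠ 1 by decide)
  have h02 := cyc_mem_cycAlgebra (k := k) (c := c) (show (0 : Fin 3) ≠ 2 by decide)
  have h12 := pow_mem (cyc_mem_cycAlgebra (k := k) (c := c) (show (1 : Fin 3) ≠ 2 by decide)) (c - 1)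
  fin_cases u <;> fin_cases v <;> fin_cases w <;>
    first
    | exact absurd rfl huv | exact absurd rfl hvw | exact absurd rfl huw
    | exact ⟨_, h02, β_δ_eq⟩ | exact ⟨_, h02, η_γ_eq⟩ | exact ⟨_, h01, δ_lam_eq⟩
    | exact ⟨_, h01, κ_η_eq⟩ | exact ⟨_, h12, lam_β_eq hc⟩ | exact ⟨_, h12, γ_κ_eq hc⟩

/-- Each Peirce component is generated by one arrow over the central subalgebra `cycAlgebra`. -/
theorem exists_idem_mul_mul_idem_eq (hc : 2 ≤ c) (b : Q3K k c) (u v : Fin 3) :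
    ∃ x ∈ cycAlgebra k c, a u u * b * a v v = x * a u v := by
  let S : Subalgebra k (Q3K k c) :=
    { carrier := {b | ∀ u v, ∃ x ∈ cycAlgebra k c, a u u * b * a v v = x * a u v}
      mul_mem' := by
        intro b b' hb hb' u v
        choose x hx hxb using hb
        choose x' hx' hxb' using hb'
        choose y hy hyb using exists_mul_eq (k := k) hc
        have key : ∀ w, (a u u * b * a w w) * (a w w * b' * a v v) =
            x u w * x' w v * y u w v * a u v := by
          intro w
          rw [hxb, hxb', mul_assoc, ← mul_assoc (a u w), cycAlgebra_comm hc (hx' w v), mul_assoc,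
            hyb]
          simp only [mul_assoc]
        have hsum : a u u * (b * b') * a v v =
            ∑ w, (a u u * b * a w w) * (a w w * b' * a v v) := by
          have : ∀ w, (a u u * b * a w w) * (a w w * b' * a v v) =
              a u u * b * (a w w * (b' * a v v)) := by
            intro w
            rw [mul_assoc _ (a w w), ← mul_assoc (a w w), ← mul_assoc (a w w), idem_mul_idem]
            simp only [mul_assoc]
          rw [Finset.sum_congr rfl fun w _ ↦ this w, ← Finset.mul_sum, ← Finset.sum_mul,
            Fin.sum_univ_three, idem_sum, one_mul]
          simp only [mul_assoc]
        refine ⟨∑ w, x u w * x' w v * y u w v, sum_mem fun w _ ↦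
          mul_mem (mul_mem (hx _ _) (hx' _ _)) (hy _ _ _), ?_⟩
        rw [hsum, Finset.sum_congr rfl fun w _ ↦ key w, Finset.sum_mul]
      add_mem' := by
        intro b b' hb hb' u v
        obtain ⟨x, hx, hxb⟩ := hb u v
        obtain ⟨x', hx', hxb'⟩ := hb' u v
        exact ⟨x + x', add_mem hx hx', by rw [mul_add, add_mul, hxb, hxb', add_mul]⟩
      algebraMap_mem' := by
        intro r u v
        by_cases h : u = v
        · subst h
          exact ⟨algebraMap k _ r, Subalgebra.algebraMap_mem _ _, by
            rw [← Algebra.commutes, mul_assoc, idem_mul_idem]⟩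
        · exact ⟨0, zero_mem _, by
            rw [← Algebra.commutes, mul_assoc, idem_mul_idem_of_ne h]; simp⟩ }
  have hS : S = ⊤ := by
    refine subalgebra_eq_top _ fun p q u v ↦ ?_
    by_cases hu : u = p
    · by_cases hv : v = q
      · subst hu hv; exact ⟨1, one_mem _, by rw [idem_mul_arrow, arrow_mul_idem, one_mul]⟩
      · exact ⟨0, zero_mem _, by rw [mul_assoc, arrow_mul_arrow_of_ne (Ne.symm hv)]; simp⟩
    · exact ⟨0, zero_mem _, by rw [arrow_mul_arrow_of_ne hu]; simp⟩
  exact (hS ▸ Algebra.mem_top : b ∈ S) u v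

/-- Associativity of the oriented triangle at a vertex: bracketing it in two ways and applying the
central form of the relations gives two expressions for the same element. The next two lemmas do
this at the other vertices. -/
lemma cyc_sq_mul_idem_zero (hc : 2 ≤ c) :
    z 0 1 * (z 0 1 * a 0 0) = z 0 2 * (z 0 2 * a 0 0) := by
  have h1 : a 0 1 * a 1 2 * a 2 0 = z 0 2 * (z 0 2 * a 0 0) := by
    rw [β_δ_eq, mul_assoc, cyc_mul_idem_left (by decide)]
  have h2 : a 0 1 * (a 1 2 * a 2 0) = z 0 1 * (z 0 1 * a 0 0) := by
    rw [δ_lam_eq, ← mul_assoc, cyc_mul_comm hc (by decide), mul_assoc,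
      cyc_mul_idem_left (by decide)]
  rw [← h1, ← h2, mul_assoc]

lemma cyc_sq_mul_idem_one (hc : 2 ≤ c) : z 0 1 * (z 0 1 * a 1 1) = z 1 2 ^ c * a 1 1 := by
  have h1 : a 1 2 * a 2 0 * a 0 1 = z 0 1 * (z 0 1 * a 1 1) := by
    rw [δ_lam_eq, mul_assoc, cyc_mul_idem_right (by decide)]
  have h2 : a 1 2 * (a 2 0 * a 0 1) = z 1 2 ^ c * a 1 1 := by
    rw [lam_β_eq hc, ← mul_assoc,
      cycAlgebra_comm hc (pow_mem (cyc_mem_cycAlgebra (by decide)) _), mul_assoc,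
      ← cyc_mul_idem_left (by decide), ← mul_assoc, ← pow_succ, Nat.sub_add_cancel (by omega)]
  rw [← h1, ← h2, mul_assoc]

lemma cyc_sq_mul_idem_two (hc : 2 ≤ c) : z 0 2 * (z 0 2 * a 2 2) = z 1 2 ^ c * a 2 2 := by
  have h1 : a 2 1 * a 1 0 * a 0 2 = z 0 2 * (z 0 2 * a 2 2) := by
    rw [η_γ_eq, mul_assoc, cyc_mul_idem_right (by decide)]
  have h2 : a 2 1 * (a 1 0 * a 0 2) = z 1 2 ^ c * a 2 2 := by
    rw [γ_κ_eq hc, ← mul_assoc,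
      cycAlgebra_comm hc (pow_mem (cyc_mem_cycAlgebra (by decide)) _), mul_assoc,
      ← cyc_mul_idem_right (by decide), ← mul_assoc, ← pow_succ, Nat.sub_add_cancel (by omega)]
  rw [← h1, ← h2, mul_assoc]

lemma cyc_zero_one_mul_idem_two : z 0 1 * a 2 2 = 0 := cyc_mul_arrow_of_ne (by decide) (by decide)
lemma cyc_zero_two_mul_idem_one : z 0 2 * a 1 1 = 0 := cyc_mul_arrow_of_ne (by decide) (by decide)
lemma cyc_one_two_mul_idem_zero : z 1 2 * a 0 0 = 0 := cyc_mul_arrow_of_ne (by decide) (by decide)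

lemma cyc_zero_one_mul_pow (hc : 2 ≤ c) (m : ℕ) : z 0 1 * z 1 2 ^ (m + 1) = 0 := by
  rw [pow_succ', ← mul_assoc, cyc_zero_one_mul_cyc_one_two hc, zero_mul]
lemma cyc_zero_two_mul_pow (hc : 2 ≤ c) (m : ℕ) : z 0 2 * z 1 2 ^ (m + 1) = 0 := by
  rw [pow_succ', ← mul_assoc, cyc_zero_two_mul_cyc_one_two hc, zero_mul]

/-- Checked vertex by vertex. At 1 and 2 the power of exponent `c` equals the square of another
cycle sum, and different cycle sums annihilate each other. The two cubes below vanish in the same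
way. -/
lemma cyc_one_two_pow_succ (hc : 2 ≤ c) : z 1 2 ^ (c + 1) = 0 := by
  refine eq_zero_of_mul_idem fun v ↦ ?_
  fin_cases v
  · show _ * a 0 0 = 0
    rw [pow_succ, mul_assoc, cyc_one_two_mul_idem_zero, mul_zero]
  · show _ * a 1 1 = 0
    rw [pow_succ', mul_assoc, ← cyc_sq_mul_idem_one hc, ← mul_assoc, cyc_mul_comm hc (by decide),
      cyc_zero_one_mul_cyc_one_two hc, zero_mul]
  · show _ * a 2 2 = 0
    rw [pow_succ', mul_assoc, ← cyc_sq_mul_idem_two hc, ← mul_assoc, cyc_mul_comm hc (by decide),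
      cyc_zero_two_mul_cyc_one_two hc, zero_mul]

lemma cyc_one_two_pow_eq_zero (hc : 2 ≤ c) {m : ℕ} (hm : c < m) : z 1 2 ^ m = 0 := by
  rw [← Nat.add_sub_of_le (Nat.succ_le_of_lt hm), pow_add, cyc_one_two_pow_succ hc, zero_mul]

lemma cyc_zero_one_cube (hc : 2 ≤ c) : z 0 1 ^ 3 = 0 := by
  refine eq_zero_of_mul_idem fun v ↦ ?_
  rw [pow_succ', pow_two, mul_assoc, mul_assoc]
  fin_cases v
  · show _ * (_ * (_ * a 0 0)) = 0
    rw [cyc_sq_mul_idem_zero hc, ← mul_assoc, cyc_zero_one_mul_cyc_zero_two hc, zero_mul]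
  · show _ * (_ * (_ * a 1 1)) = 0
    rw [cyc_sq_mul_idem_one hc, ← mul_assoc, ← Nat.sub_add_cancel (show 1 ≤ c by omega),
      cyc_zero_one_mul_pow (by omega), zero_mul]
  · show _ * (_ * (_ * a 2 2)) = 0
    rw [cyc_zero_one_mul_idem_two]; simp

lemma cyc_zero_two_cube (hc : 2 ≤ c) : z 0 2 ^ 3 = 0 := by
  refine eq_zero_of_mul_idem fun v ↦ ?_
  rw [pow_succ', pow_two, mul_assoc, mul_assoc]
  fin_cases v
  · show _ * (_ * (_ * a 0 0)) = 0
    rw [← cyc_sq_mul_idem_zero hc, ← mul_assoc, cyc_mul_comm hc (by decide),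
      cyc_zero_one_mul_cyc_zero_two hc, zero_mul]
  · show _ * (_ * (_ * a 1 1)) = 0
    rw [cyc_zero_two_mul_idem_one]; simp
  · show _ * (_ * (_ * a 2 2)) = 0
    rw [cyc_sq_mul_idem_two hc, ← mul_assoc, ← Nat.sub_add_cancel (show 1 ≤ c by omega),
      cyc_zero_two_mul_pow (by omega), zero_mul]

lemma isNilpotent_cyc (hc : 2 ≤ c) {u v : Fin 3} (h : u ≠ v) : IsNilpotent (z u v) := by
  have h1 : IsNilpotent (z 0 1) := ⟨3, cyc_zero_one_cube hc⟩
  have h2 : IsNilpotent (z 0 2) := ⟨3, cyc_zero_two_cube hc⟩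
  have h3 : IsNilpotent (z 1 2) := ⟨_, cyc_one_two_pow_succ hc⟩
  fin_cases u <;> fin_cases v <;>
    first | exact absurd rfl h | assumption | (rw [cyc_comm]; assumption)

/-- The generators are nilpotent and commute, so every polynomial in them differs from its constant
term by a nilpotent element. Over a field this says that the algebra of cycles is local. -/
lemma exists_isNilpotent_sub (hc : 2 ≤ c) {x : Q3K k c} (hx : x ∈ cycAlgebra k c) :
    ∃ r : k, IsNilpotent (x - algebraMap k _ r) := by
  induction hx using Algebra.adjoin_induction with
  | mem x hx =>
    refine ⟨0, ?_⟩
    rw [map_zero, sub_zero]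
    rcases hx with rfl | rfl | rfl <;> exact isNilpotent_cyc hc (by decide)
  | algebraMap r => exact ⟨r, by simp⟩
  | add x y hx hy ihx ihy =>
    obtain ⟨r, hr⟩ := ihx
    obtain ⟨s, hs⟩ := ihy
    refine ⟨r + s, ?_⟩
    rw [map_add, add_sub_add_comm]
    refine Commute.isNilpotent_add ?_ hr hs
    exact (cycAlgebra_comm hc (sub_mem hy (Subalgebra.algebraMap_mem _ s)) _)
  | mul x y hx hy ihx ihy =>
    obtain ⟨r, hr⟩ := ihx
    obtain ⟨s, hs⟩ := ihy
    refine ⟨r * s, ?_⟩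
    have : x * y - algebraMap k _ (r * s) =
        x * (y - algebraMap k _ s) + algebraMap k _ s * (x - algebraMap k _ r) := by
      rw [map_mul, Algebra.commutes r, mul_sub, mul_sub, Algebra.commutes s x]; abel
    rw [this]
    refine Commute.isNilpotent_add ?_ (Commute.isNilpotent_mul_left ?_ hs)
      (Commute.isNilpotent_mul_left ?_ hr)
    · exact cycAlgebra_comm hc (mul_mem (Subalgebra.algebraMap_mem _ s)
        (sub_mem hx (Subalgebra.algebraMap_mem _ r))) _
    · exact cycAlgebra_comm hc (sub_mem hy (Subalgebra.algebraMap_mem _ s)) _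
    · exact Algebra.commutes _ _

/-- An idempotent below one of the vertices is trivial. -/
lemma idempotent_eq_zero_or_eq {k : Type*} [Field k] {c : ℕ} (hc : 2 ≤ c) {f : Q3K k c}
    (hf : f * f = f) {v : Fin 3} (h1 : arrow k c v v * f = f) (h2 : f * arrow k c v v = f) :
    f = 0 ∨ f = arrow k c v v := by
  obtain ⟨x, hx, hxf⟩ := exists_idem_mul_mul_idem_eq hc f v v
  rw [h1, h2] at hxf
  obtain ⟨r, m, hr⟩ := exists_isNilpotent_sub hc hx
  -- Since `x * f = f`, a nilpotent `x` forces `f = 0`. If instead `r ≠ 0`, then `r - x` is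
  -- nilpotent but acts on the complement of `f` as the invertible scalar `r`, so the complement is
  -- zero.
  by_cases h0 : r = 0
  · left
    subst h0
    rw [map_zero, sub_zero] at hr
    have : ∀ m : ℕ, x ^ m * f = f := by
      intro m
      induction m with
      | zero => simp
      | succ m ih =>
        rw [pow_succ, mul_assoc]
        have : x * f = f := by
          nth_rewrite 2 [← hf]
          nth_rewrite 2 [hxf]
          rw [mul_assoc, h1]
        rw [this, ih]
    rw [← this m, hr, zero_mul]
  · right
    obtain ⟨m, hr⟩ : IsNilpotent (algebraMap k _ r - x) := by
      have := IsNilpotent.neg ⟨m, hr⟩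
      rwa [neg_sub] at this
    have hg : (algebraMap k _ r - x) * (arrow k c v v - f) = r • (arrow k c v v - f) := by
      have hg0 : x * (arrow k c v v - f) = 0 := by
        have : x * f = f := by
          nth_rewrite 2 [← hf]
          nth_rewrite 2 [hxf]
          rw [mul_assoc, h1]
        rw [mul_sub, this, ← hxf, sub_self]
      rw [sub_mul, hg0, sub_zero, Algebra.smul_def]
    have hpow : ∀ m : ℕ, (algebraMap k _ r - x) ^ m * (arrow k c v v - f) =
        r ^ m • (arrow k c v v - f) := by
      intro m
      induction m with
      | zero => simp
      | succ m ih => rw [pow_succ, mul_assoc, hg, mul_smul_comm, ih, smul_smul, pow_succ']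
    have h0' := hpow m
    rw [hr, zero_mul] at h0'
    have := (smul_eq_zero.1 h0'.symm).resolve_left (pow_ne_zero _ h0)
    exact (sub_eq_zero.1 this).symm

end Q3K

/-! ### The quiver algebra modulo commutators. -/

/-- The submodule spanned by all commutators. -/
def commutatorSpan (R S : Type*) [CommRing R] [Ring S] [Algebra R S] : Submodule R S :=
  Submodule.span R {x | ∃ s t : S, x = s * t - t * s}

lemma mul_sub_mul_mem_commutatorSpan {R S : Type*} [CommRing R] [Ring S] [Algebra R S] (s t : S) :
    s * t - t * s ∈ commutatorSpan R S :=
  Submodule.subset_span ⟨s, t, rfl⟩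

namespace Q3K

variable {k : Type*} [CommRing k] {c : ℕ}

local notation "a" => arrow k c
local notation "z" => cyc k c

variable (k c) in
/-- A family of representatives which spans `Q3K k c` modulo commutators. -/
noncomputable def classRep : Fin 3 ⊕ Fin 2 ⊕ Fin c → Q3K k c :=
  Sum.elim (fun v ↦ a v v) (Sum.elim ![z 0 1 * a 0 0, z 0 2 * a 0 0]
    (fun i ↦ z 1 2 ^ (i.1 + 1) * a 1 1))

variable (k c) in
/-- The span of `classRep` and of all commutators. -/
noncomputable def classSpan : Submodule k (Q3K k c) :=
  Submodule.span k (Set.range (classRep k c)) ⊔ commutatorSpan k (Q3K k c)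

lemma classRep_mem (i) : classRep k c i ∈ classSpan k c :=
  Submodule.mem_sup_left (Submodule.subset_span ⟨i, rfl⟩)

lemma idem_mem_classSpan (v : Fin 3) : a v v ∈ classSpan k c := classRep_mem (Sum.inl v)

lemma mul_mem_of_mem_cycAlgebra {N : Submodule k (Q3K k c)} (h : ∀ y ∈ N,
    z 0 1 * y ∈ N ∧ z 0 2 * y ∈ N ∧ z 1 2 * y ∈ N) {x : Q3K k c} (hx : x ∈ cycAlgebra k c) :
    ∀ y ∈ N, x * y ∈ N := by
  induction hx using Algebra.adjoin_induction with
  | mem x hx =>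
    intro y hy
    rcases hx with rfl | rfl | rfl
    exacts [(h y hy).1, (h y hy).2.1, (h y hy).2.2]
  | algebraMap r => intro y hy; rw [← Algebra.smul_def]; exact N.smul_mem r hy
  | add x x' _ _ ihx ihx' => intro y hy; rw [add_mul]; exact N.add_mem (ihx y hy) (ihx' y hy)
  | mul x x' _ _ ihx ihx' => intro y hy; rw [mul_assoc]; exact ihx _ (ihx' y hy)

lemma mul_mem_span_of_mem_cycAlgebra {s : Set (Q3K k c)} (h : ∀ y ∈ s,
    z 0 1 * y ∈ Submodule.span k s ∧ z 0 2 * y ∈ Submodule.span k s ∧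
    z 1 2 * y ∈ Submodule.span k s) {x : Q3K k c} (hx : x ∈ cycAlgebra k c) {y : Q3K k c}
    (hy : y ∈ s) : x * y ∈ Submodule.span k s := by
  refine mul_mem_of_mem_cycAlgebra (fun t ht ↦ ?_) hx y (Submodule.subset_span hy)
  induction ht using Submodule.span_induction with
  | mem t ht => exact h t ht
  | zero => simp
  | add t t' _ _ h1 h2 =>
    simp only [mul_add]
    exact ⟨add_mem h1.1 h2.1, add_mem h1.2.1 h2.2.1, add_mem h1.2.2 h2.2.2⟩
  | smul r t _ h1 =>
    simp only [mul_smul_comm]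
    exact ⟨Submodule.smul_mem _ r h1.1, Submodule.smul_mem _ r h1.2.1,
      Submodule.smul_mem _ r h1.2.2⟩

/-- Modulo commutators, a multiple of a two-cycle may be rotated. -/
lemma mul_cyc_mul_idem_sub_mem (hc : 2 ≤ c) {x : Q3K k c} (hx : x ∈ cycAlgebra k c) {u v : Fin 3}
    (h : u ≠ v) : x * (z u v * a u u) - x * (z u v * a v v) ∈ commutatorSpan k (Q3K k c) := by
  rw [cyc_mul_idem_left h, cyc_mul_idem_right h]
  have : x * (a v u * a u v) = a v u * (x * a u v) := by
    rw [← mul_assoc, ← mul_assoc, cycAlgebra_comm hc hx]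
  rw [this, ← mul_assoc]
  exact mul_sub_mul_mem_commutatorSpan _ _

lemma mem_classSpan_of_sub_mem {x y : Q3K k c} (h : x - y ∈ commutatorSpan k (Q3K k c))
    (hx : x ∈ classSpan k c) : y ∈ classSpan k c := by
  rw [← sub_sub_cancel x y]
  exact sub_mem hx (Submodule.mem_sup_right h)

lemma cyc_one_two_pow_mul_idem_one_mem (hc : 2 ≤ c) (m : ℕ) :
    z 1 2 ^ m * a 1 1 ∈ classSpan k c := by
  rcases Nat.eq_zero_or_pos m with rfl | hm
  · rw [pow_zero, one_mul]; exact idem_mem_classSpan 1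
  by_cases hmc : c < m
  · rw [cyc_one_two_pow_eq_zero hc hmc, zero_mul]; exact zero_mem _
  · have := classRep_mem (k := k) (Sum.inr (Sum.inr (⟨m - 1, by omega⟩ : Fin c)))
    simpa [classRep, Nat.sub_add_cancel (show 1 ≤ m from hm)] using this

lemma cyc_one_two_pow_mul_idem_two_mem (hc : 2 ≤ c) (m : ℕ) :
    z 1 2 ^ m * a 2 2 ∈ classSpan k c := by
  rcases Nat.eq_zero_or_pos m with rfl | hm
  · rw [pow_zero, one_mul]; exact idem_mem_classSpan 2
  obtain ⟨m, rfl⟩ := Nat.exists_eq_succ_of_ne_zero hm.ne'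
  refine mem_classSpan_of_sub_mem ?_ (cyc_one_two_pow_mul_idem_one_mem hc (m + 1))
  rw [pow_succ, mul_assoc, mul_assoc]
  exact mul_cyc_mul_idem_sub_mem hc (pow_mem (cyc_mem_cycAlgebra (by decide)) m) (by decide)

lemma cyc_zero_one_mul_idem_zero_mem : z 0 1 * a 0 0 ∈ classSpan k c := by
  simpa [classRep] using classRep_mem (k := k) (c := c) (Sum.inr (Sum.inl 0))

lemma cyc_zero_two_mul_idem_zero_mem : z 0 2 * a 0 0 ∈ classSpan k c := by
  simpa [classRep] using classRep_mem (k := k) (c := c) (Sum.inr (Sum.inl 1))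

lemma cyc_zero_one_mul_idem_one_mem (hc : 2 ≤ c) : z 0 1 * a 1 1 ∈ classSpan k c := by
  refine mem_classSpan_of_sub_mem ?_ cyc_zero_one_mul_idem_zero_mem
  simpa using mul_cyc_mul_idem_sub_mem (k := k) hc (one_mem _) (show (0 : Fin 3) ≠ 1 by decide)

lemma cyc_zero_two_mul_idem_two_mem (hc : 2 ≤ c) : z 0 2 * a 2 2 ∈ classSpan k c := by
  refine mem_classSpan_of_sub_mem ?_ cyc_zero_two_mul_idem_zero_mem
  simpa using mul_cyc_mul_idem_sub_mem (k := k) hc (one_mem _) (show (0 : Fin 3) ≠ 2 by decide)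

/-- Rotation moves the squared cycle from vertex 0 to vertex 1, where it equals the top power of `z
1 2`, so it needs no representative of its own. -/
lemma cyc_sq_mul_idem_zero_mem (hc : 2 ≤ c) : z 0 1 * (z 0 1 * a 0 0) ∈ classSpan k c := by
  have := mul_cyc_mul_idem_sub_mem (k := k) hc (cyc_mem_cycAlgebra (show (0 : Fin 3) ≠ 1 by decide))
    (show (0 : Fin 3) ≠ 1 by decide)
  have h2 : _ ∈ classSpan k c := Submodule.mem_sup_right this
  have h3 := cyc_one_two_pow_mul_idem_one_mem (k := k) hc c
  rw [← cyc_sq_mul_idem_one hc] at h3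
  simpa using add_mem h2 h3

/-- The span of the four listed elements is stable under the generators of the algebra of cycles. It
closes up because the squares of the two cycle sums agree at vertex 0, while mixed products vanish.
-/
lemma mul_idem_zero_mem (hc : 2 ≤ c) {x : Q3K k c} (hx : x ∈ cycAlgebra k c) :
    x * a 0 0 ∈ classSpan k c := by
  let s : Set (Q3K k c) := {a 0 0, z 0 1 * a 0 0, z 0 2 * a 0 0, z 0 1 * (z 0 1 * a 0 0)}
  have hs : ∀ y ∈ s, y ∈ Submodule.span k s := fun y hy ↦ Submodule.subset_span hy
  have hle : Submodule.span k s ≤ classSpan k c := by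
    rw [Submodule.span_le]
    rintro _ (rfl | rfl | rfl | rfl)
    exacts [idem_mem_classSpan 0, cyc_zero_one_mul_idem_zero_mem, cyc_zero_two_mul_idem_zero_mem,
      cyc_sq_mul_idem_zero_mem hc]
  have h3 : ∀ t ∈ cycAlgebra k c, z 1 2 * (t * a 0 0) = 0 := by
    intro t ht
    rw [← mul_assoc, cycAlgebra_comm hc ht, mul_assoc, cyc_one_two_mul_idem_zero, mul_zero]
  have h01 := cyc_mem_cycAlgebra (k := k) (c := c) (show (0 : Fin 3) ≠ 1 by decide)
  have h02 := cyc_mem_cycAlgebra (k := k) (c := c) (show (0 : Fin 3) ≠ 2 by decide)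
  have h10 : z 0 2 * z 0 1 = 0 := by
    rw [cyc_mul_comm hc (by decide), cyc_zero_one_mul_cyc_zero_two hc]
  refine hle (mul_mem_span_of_mem_cycAlgebra ?_ hx (Set.mem_insert _ _))
  rintro _ (rfl | rfl | rfl | rfl)
  · refine ⟨hs _ (by simp [s]), hs _ (by simp [s]), ?_⟩
    rw [cyc_one_two_mul_idem_zero]; exact zero_mem _
  · refine ⟨hs _ (by simp [s]), ?_, ?_⟩
    · rw [← mul_assoc, h10, zero_mul]; exact zero_mem _
    · rw [h3 _ h01]; exact zero_mem _
  · refine ⟨?_, ?_, ?_⟩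
    · rw [← mul_assoc, cyc_zero_one_mul_cyc_zero_two hc, zero_mul]; exact zero_mem _
    · rw [← cyc_sq_mul_idem_zero hc]; exact hs _ (by simp [s])
    · rw [h3 _ h02]; exact zero_mem _
  · refine ⟨?_, ?_, ?_⟩
    · rw [cyc_sq_mul_idem_zero hc, ← mul_assoc, cyc_zero_one_mul_cyc_zero_two hc, zero_mul]
      exact zero_mem _
    · rw [← mul_assoc, h10, zero_mul]; exact zero_mem _
    · rw [← mul_assoc (z 0 1), h3 _ (mul_mem h01 h01)]; exact zero_mem _

/-- Common argument for vertices 1 and 2: `p` is the cycle sum of the edge joining `v` to 0, and `q`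
that of the edge from 0 which misses `v`. The span of `p * a v v` and all `z 1 2 ^ m * a v v` is
stable, since `p` squared is again a power of `z 1 2` at `v`. -/
lemma mul_idem_mem_of_relations (hc : 2 ≤ c) {p q : Q3K k c} {v : Fin 3}
    (hpq : p = z 0 1 ∧ q = z 0 2 ∨ p = z 0 2 ∧ q = z 0 1) (hq : q * a v v = 0)
    (hp : p * (p * a v v) = z 1 2 ^ c * a v v) (hpm : p * a v v ∈ classSpan k c)
    (hzm : ∀ m, z 1 2 ^ m * a v v ∈ classSpan k c) {x : Q3K k c} (hx : x ∈ cycAlgebra k c) :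
    x * a v v ∈ classSpan k c := by
  let s : Set (Q3K k c) := insert (p * a v v) (Set.range fun m : ℕ ↦ z 1 2 ^ m * a v v)
  have hle : Submodule.span k s ≤ classSpan k c := by
    rw [Submodule.span_le]
    rintro _ (rfl | ⟨m, rfl⟩)
    exacts [hpm, hzm m]
  have hs1 : p * a v v ∈ Submodule.span k s := Submodule.subset_span (Set.mem_insert _ _)
  have hs2 : ∀ m, z 1 2 ^ m * a v v ∈ Submodule.span k s := fun m ↦
    Submodule.subset_span (Set.mem_insert_of_mem _ ⟨m, rfl⟩)
  have hpc : p ∈ cycAlgebra k c := by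
    rcases hpq with ⟨rfl, -⟩ | ⟨rfl, -⟩ <;> exact cyc_mem_cycAlgebra (by decide)
  have hqp : q * p = 0 := by
    rcases hpq with ⟨rfl, rfl⟩ | ⟨rfl, rfl⟩
    · rw [cyc_mul_comm hc (by decide), cyc_zero_one_mul_cyc_zero_two hc]
    · exact cyc_zero_one_mul_cyc_zero_two hc
  have hpz : p * z 1 2 = 0 := by
    rcases hpq with ⟨rfl, rfl⟩ | ⟨rfl, rfl⟩
    exacts [cyc_zero_one_mul_cyc_one_two hc, cyc_zero_two_mul_cyc_one_two hc]
  have hmain : ∀ y ∈ s, p * y ∈ Submodule.span k s ∧ q * y ∈ Submodule.span k s ∧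
      z 1 2 * y ∈ Submodule.span k s := by
    rintro _ (rfl | ⟨m, rfl⟩)
    · refine ⟨hp ▸ hs2 c, ?_, ?_⟩
      · rw [← mul_assoc, hqp, zero_mul]; exact zero_mem _
      · rw [← mul_assoc, cycAlgebra_comm hc hpc, hpz, zero_mul]; exact zero_mem _
    · refine ⟨?_, ?_, ?_⟩
      · cases m with
        | zero => simpa using hs1
        | succ m =>
          show p * (z 1 2 ^ (m + 1) * a v v) ∈ _
          rw [pow_succ', ← mul_assoc, ← mul_assoc, hpz]; simp
      · show q * (z 1 2 ^ m * a v v) ∈ _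
        rw [← mul_assoc, cycAlgebra_comm hc (pow_mem (cyc_mem_cycAlgebra (show (1 : Fin 3) ≠ 2 by decide)) m),
          mul_assoc, hq, mul_zero]
        exact zero_mem _
      · show z 1 2 * (z 1 2 ^ m * a v v) ∈ _
        rw [← mul_assoc, ← pow_succ']
        exact hs2 _
  refine hle (mul_mem_span_of_mem_cycAlgebra (fun y hy ↦ ?_) hx
    (Set.mem_insert_of_mem _ ⟨0, by simp⟩))
  rcases hpq with ⟨rfl, rfl⟩ | ⟨rfl, rfl⟩
  · exact hmain y hy
  · exact ⟨(hmain y hy).2.1, (hmain y hy).1, (hmain y hy).2.2⟩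

lemma mul_idem_mem_classSpan (hc : 2 ≤ c) {x : Q3K k c} (hx : x ∈ cycAlgebra k c) (v : Fin 3) :
    x * a v v ∈ classSpan k c := by
  fin_cases v
  · exact mul_idem_zero_mem hc hx
  · exact mul_idem_mem_of_relations hc (Or.inl ⟨rfl, rfl⟩) cyc_zero_two_mul_idem_one
      (cyc_sq_mul_idem_one hc) (cyc_zero_one_mul_idem_one_mem hc)
      (cyc_one_two_pow_mul_idem_one_mem hc) hx
  · exact mul_idem_mem_of_relations hc (Or.inr ⟨rfl, rfl⟩) cyc_zero_one_mul_idem_two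
      (cyc_sq_mul_idem_two hc) (cyc_zero_two_mul_idem_two_mem hc)
      (cyc_one_two_pow_mul_idem_two_mem hc) hx

/-- The family `classRep` spans `Q3K k c` modulo commutators. -/
theorem classSpan_eq_top (hc : 2 ≤ c) : classSpan k c = ⊤ := by
  rw [eq_top_iff]
  rintro b -
  have hb : b = ∑ u, ∑ v, a u u * b * a v v := by
    have h1 : ∑ v, a v v = 1 := by rw [Fin.sum_univ_three, idem_sum]
    simp only [← Finset.mul_sum, ← Finset.sum_mul, h1, one_mul, mul_one]
  rw [hb]
  refine sum_mem fun u _ ↦ sum_mem fun v _ ↦ ?_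
  by_cases h : u = v
  · subst h
    obtain ⟨x, hx, hxb⟩ := exists_idem_mul_mul_idem_eq hc b u u
    rw [hxb]
    exact mul_idem_mem_classSpan hc hx u
  · refine Submodule.mem_sup_right ?_
    have := mul_sub_mul_mem_commutatorSpan (R := k) (a u u * b) (a v v)
    rwa [← mul_assoc, arrow_mul_arrow_of_ne (Ne.symm h), zero_mul, sub_zero] at this

/-- Modulo commutators, all oriented triangles agree with one member of `classRep`. -/
theorem triangle_sub_mem (hc : 2 ≤ c) {u v w : Fin 3} (huv : u ≠ v) (hvw : v ≠ w) (huw : u ≠ w) :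
    a u v * a v w * a w u - classRep k c (Sum.inr (Sum.inr ⟨c - 1, by omega⟩)) ∈
      commutatorSpan k (Q3K k c) := by
  have hrep : classRep k c (Sum.inr (Sum.inr ⟨c - 1, by omega⟩)) = z 1 2 ^ c * a 1 1 := by
    simp [classRep, Nat.sub_add_cancel (show 1 ≤ c by omega)]
  rw [hrep]
  -- The two orientations of the triangle based at vertex 1 give the same element. Rotating each by
  -- commutators covers all six triangles.
  have h1 : a 1 2 * a 2 0 * a 0 1 = z 1 2 ^ c * a 1 1 := by
    rw [δ_lam_eq, mul_assoc, ← cyc_sq_mul_idem_one hc, cyc_mul_idem_right (by decide)]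
  have h2 : a 1 0 * a 0 2 * a 2 1 = z 1 2 ^ c * a 1 1 := by
    rw [γ_κ_eq hc, mul_assoc, ← cyc_mul_idem_left (by decide), ← mul_assoc, ← pow_succ,
      Nat.sub_add_cancel (by omega)]
  have rot : ∀ {u v w : Fin 3} {y : Q3K k c}, a u v * a v w * a w u - y ∈
      commutatorSpan k (Q3K k c) → a v w * a w u * a u v - y ∈ commutatorSpan k (Q3K k c) := by
    intro u v w y h
    have := mul_sub_mul_mem_commutatorSpan (R := k) (a v w * a w u) (a u v)
    rw [← mul_assoc (a u v)] at this
    simpa using add_mem this h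
  have h1' := rot (u := 1) (v := 2) (w := 0) (sub_eq_zero.2 h1 ▸ zero_mem _)
  have h2' := rot (u := 1) (v := 0) (w := 2) (sub_eq_zero.2 h2 ▸ zero_mem _)
  have h1'' := rot h1'
  have h2'' := rot h2'
  have h0 := rot h1''
  have h0' := rot h2''
  fin_cases u <;> fin_cases v <;> fin_cases w <;>
    first
    | exact absurd rfl huv | exact absurd rfl hvw | exact absurd rfl huw | assumption

end Q3K

/-! ### Reduction modulo the uniformizer, completeness, and lifting of idempotents. -/

open IsLocalRing in
/-- `ρ` is the reduction of the `O`-algebra `S` modulo the uniformizer `ϖ`. -/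
structure IsReduction {O S B : Type*} [CommRing O] [IsLocalRing O] [Ring S] [Algebra O S] [Ring B]
    [Algebra (ResidueField O) B] (ϖ : O) (ρ : S →+* B) : Prop where
  irreducible : Irreducible ϖ
  surjective : Function.Surjective ρ
  map_smul_eq : ∀ (r : O) (s : S), ρ (r • s) = residue O r • ρ s
  exists_eq_smul : ∀ s, ρ s = 0 → ∃ s', s = ϖ • s'

section Complete

variable {O : Type*} [CommRing O] [IsDomain O] [IsDiscreteValuationRing O] {ϖ : O}

lemma mem_maximalIdeal_pow_smul_top_iff {M : Type*} [AddCommGroup M] [Module O M]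
    (hϖ : Irreducible ϖ) (n : ℕ) (x : M) :
    x ∈ (IsLocalRing.maximalIdeal O ^ n • ⊤ : Submodule O M) ↔ ∃ y, x = ϖ ^ n • y := by
  rw [hϖ.maximalIdeal_eq, Ideal.span_singleton_pow, Submodule.ideal_span_singleton_smul,
    Submodule.mem_smul_pointwise_iff_exists]
  simp [eq_comm]

lemma mem_maximalIdeal_smul_top_iff {M : Type*} [AddCommGroup M] [Module O M]
    (hϖ : Irreducible ϖ) (x : M) :
    x ∈ (IsLocalRing.maximalIdeal O • ⊤ : Submodule O M) ↔ ∃ y, x = ϖ • y := by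
  simpa using mem_maximalIdeal_pow_smul_top_iff hϖ 1 x

lemma eq_zero_of_forall_exists_eq_pow_smul {M : Type*} [AddCommGroup M] [Module O M]
    [Module.Finite O M] (hϖ : Irreducible ϖ) {x : M} (h : ∀ n : ℕ, ∃ y, x = ϖ ^ n • y) : x = 0 := by
  refine IsHausdorff.haus (I := IsLocalRing.maximalIdeal O) inferInstance x fun n ↦ ?_
  rw [SModEq.zero, mem_maximalIdeal_pow_smul_top_iff hϖ]
  exact h n

variable [IsAdicComplete (IsLocalRing.maximalIdeal O) O]

lemma exists_limit (hϖ : Irreducible ϖ) (f : ℕ → O) (h : ∀ n, ∃ w, f (n + 1) - f n = ϖ ^ n * w) :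
    ∃ L, ∀ n, ∃ w, L - f n = ϖ ^ n * w := by
  have key : ∀ {m n : ℕ}, m ≤ n →
      f m ≡ f n [SMOD (IsLocalRing.maximalIdeal O ^ m • ⊤ : Submodule O O)] := by
    intro m n hmn
    induction n, hmn using Nat.le_induction with
    | base => rfl
    | succ n hmn ih =>
      refine ih.trans ?_
      symm
      rw [SModEq.sub_mem, mem_maximalIdeal_pow_smul_top_iff hϖ]
      obtain ⟨w, hw⟩ := h n
      exact ⟨ϖ ^ (n - m) * w, by
        rw [hw, smul_eq_mul, ← mul_assoc, ← pow_add, Nat.add_sub_of_le hmn]⟩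
  obtain ⟨L, hL⟩ := IsPrecomplete.prec (I := IsLocalRing.maximalIdeal O) (M := O)
    inferInstance key
  refine ⟨L, fun n ↦ ?_⟩
  have := (hL n).symm
  rwa [SModEq.sub_mem, mem_maximalIdeal_pow_smul_top_iff hϖ] at this

lemma exists_limit_module {M : Type*} [AddCommGroup M] [Module O M] [Module.Finite O M]
    [Module.Free O M] (hϖ : Irreducible ϖ) (x : ℕ → M)
    (h : ∀ n, ∃ w, x (n + 1) - x n = ϖ ^ n • w) : ∃ L, ∀ n, ∃ w, L - x n = ϖ ^ n • w := by
  let b := Module.Free.chooseBasis O M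
  have hc : ∀ j, ∃ L, ∀ n, ∃ w, L - b.repr (x n) j = ϖ ^ n * w := by
    intro j
    refine exists_limit hϖ _ fun n ↦ ?_
    obtain ⟨w, hw⟩ := h n
    refine ⟨b.repr w j, ?_⟩
    have := congrArg (fun y ↦ b.repr y j) hw
    simpa using this
  choose L w hw using hc
  refine ⟨∑ j, L j • b j, fun n ↦ ⟨∑ j, w j n • b j, ?_⟩⟩
  rw [Finset.smul_sum]
  nth_rewrite 1 [← b.sum_repr (x n)]
  rw [← Finset.sum_sub_distrib]
  refine Finset.sum_congr rfl fun j _ ↦ ?_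
  rw [← sub_smul, hw, mul_smul]

variable {S : Type*} [Ring S] [Algebra O S] [Module.Finite O S] [Module.Free O S]

/-- Lifting of idempotents modulo `ϖ`. -/
lemma exists_idempotent_lift (hϖ : Irreducible ϖ) (y : S) (hy : ∃ w, y * y - y = ϖ • w) :
    ∃ f : S, f * f = f ∧ (∃ w, f - y = ϖ • w) ∧ (∀ g, g * y = 0 → g * f = 0) ∧
      (∀ g, y * g = 0 → f * g = 0) := by
  -- Newton iteration for x² = x: the error x² - x of the next iterate is divisible by the square of
  -- the present error. Each iterate is a multiple of `y` on both sides, so annihilators of `y`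
  -- survive in the limit.
  let step : S → S := fun x ↦ x * x * (3 - 2 * x)
  let x : ℕ → S := fun n ↦ step^[n] y
  have hx0 : x 0 = y := rfl
  have hx : ∀ n, x (n + 1) = step (x n) := fun n ↦ Function.iterate_succ_apply' step n y
  have hid : ∀ n, ∃ w, x n * x n - x n = ϖ ^ (n + 1) • w := by
    intro n
    induction n with
    | zero => simpa [hx0] using hy
    | succ n ih =>
      obtain ⟨w, hw⟩ := ih
      have h1 : step (x n) * step (x n) - step (x n) =
          (x n * x n - x n) * (x n * x n - x n) * (4 * (x n * x n) - 4 * x n - 3) := by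
        simp only [step]; noncomm_ring
      refine ⟨ϖ ^ n • (w * w * (4 * (x n * x n) - 4 * x n - 3)), ?_⟩
      rw [hx, h1, hw, smul_mul_smul_comm, smul_mul_assoc, smul_smul]
      ring_nf
  have hdiff : ∀ n, ∃ w, x (n + 1) - x n = ϖ ^ (n + 1) • w := by
    intro n
    obtain ⟨w, hw⟩ := hid n
    have h1 : step (x n) - x n = (x n * x n - x n) * (1 - 2 * x n) := by
      simp only [step]; noncomm_ring
    exact ⟨w * (1 - 2 * x n), by rw [hx, h1, hw, smul_mul_assoc]⟩
  obtain ⟨f, hf⟩ := exists_limit_module hϖ x fun n ↦ by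
    obtain ⟨w, hw⟩ := hdiff n
    exact ⟨ϖ • w, by rw [hw, smul_smul, pow_succ]⟩
  refine ⟨f, ?_, ?_, ?_, ?_⟩
  · rw [← sub_eq_zero]
    refine eq_zero_of_forall_exists_eq_pow_smul hϖ fun n ↦ ?_
    obtain ⟨w, hw⟩ := hf n
    obtain ⟨v, hv⟩ := hid n
    have : f * f - f = (f - x n) * f + x n * (f - x n) - (f - x n) + (x n * x n - x n) := by
      noncomm_ring
    exact ⟨w * f + x n * w - w + ϖ • v, by
      rw [this, hw, hv, smul_mul_assoc, mul_smul_comm, smul_add, smul_sub, smul_add, smul_smul,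
        pow_succ]⟩
  · obtain ⟨w, hw⟩ := hf 1
    obtain ⟨v, hv⟩ := hdiff 0
    refine ⟨w + v, ?_⟩
    have : f - y = (f - x 1) + (x (0 + 1) - x 0) := by rw [hx0]; simp
    rw [this, hw, hv, smul_add]; simp
  · intro g hg
    have hgx : ∀ n, g * x n = 0 := by
      intro n
      induction n with
      | zero => exact hg
      | succ n ih => rw [hx]; simp only [step]; rw [← mul_assoc, ← mul_assoc, ih]; simp
    refine eq_zero_of_forall_exists_eq_pow_smul hϖ fun n ↦ ?_
    obtain ⟨w, hw⟩ := hf n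
    exact ⟨g * w, by rw [← mul_smul_comm, ← hw, mul_sub, hgx, sub_zero]⟩
  · intro g hg
    have hgx : ∀ n, x n * g = 0 := by
      intro n
      induction n with
      | zero => exact hg
      | succ n ih =>
        rw [hx]; simp only [step]
        have : x n * x n * (3 - 2 * x n) * g = x n * (3 - 2 * x n) * (x n * g) := by noncomm_ring
        rw [this, ih, mul_zero]
    refine eq_zero_of_forall_exists_eq_pow_smul hϖ fun n ↦ ?_
    obtain ⟨w, hw⟩ := hf n
    exact ⟨w * g, by rw [← smul_mul_assoc, ← hw, sub_mul, hgx, sub_zero]⟩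

end Complete

namespace IsReduction

open IsLocalRing

variable {O : Type*} [CommRing O] [IsDomain O] [IsDiscreteValuationRing O] {ϖ : O}
variable {S : Type*} [Ring S] [Algebra O S]
variable {B : Type*} [Ring B] [Algebra (ResidueField O) B] {ρ : S →+* B}

section
variable (h : IsReduction ϖ ρ)
include h

lemma residue_eq_zero : residue O ϖ = 0 := by
  rw [residue_eq_zero_iff, h.irreducible.maximalIdeal_eq]
  exact Ideal.mem_span_singleton_self ϖ

lemma map_eq_zero (s : S) : ρ (ϖ • s) = 0 := by
  rw [h.map_smul_eq, h.residue_eq_zero, zero_smul]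

lemma exists_sub_eq_smul {s s' : S} (hs : ρ s = ρ s') : ∃ w, s - s' = ϖ • w :=
  h.exists_eq_smul _ (by rw [map_sub, hs, sub_self])

/-- An idempotent of `S` which vanishes in the reduction is zero. -/
lemma idempotent_eq_zero [Module.Finite O S] {f : S} (hf : f * f = f) (h0 : ρ f = 0) : f = 0 := by
  obtain ⟨w, hw⟩ := h.exists_eq_smul f h0
  refine eq_zero_of_forall_exists_eq_pow_smul h.irreducible fun n ↦ ?_
  induction n with
  | zero => exact ⟨f, by simp⟩
  | succ n ih =>
    obtain ⟨v, hv⟩ := ih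
    refine ⟨v * w, ?_⟩
    nth_rewrite 1 [← hf]
    nth_rewrite 1 [hv]
    rw [hw, smul_mul_smul_comm, pow_succ]

end

end IsReduction

/-! ### Cocentre and centre of a symmetric order that reduces to the quiver algebra. -/

namespace IsReduction

open IsLocalRing Q3K

variable {O : Type*} [CommRing O] [IsDomain O] [IsDiscreteValuationRing O] {ϖ : O}
variable {S : Type*} [Ring S] [Algebra O S]

section General

variable {B : Type*} [Ring B] [Algebra (ResidueField O) B] {ρ : S →+* B}

/-- The image of an `O`-submodule under the reduction. -/
def mapSubmodule (h : IsReduction ϖ ρ) (N : Submodule O S) : Submodule (ResidueField O) B where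
  carrier := ρ '' N
  add_mem' := by
    rintro _ _ ⟨x, hx, rfl⟩ ⟨y, hy, rfl⟩
    exact ⟨x + y, N.add_mem hx hy, map_add _ _ _⟩
  zero_mem' := ⟨0, N.zero_mem, map_zero _⟩
  smul_mem' := by
    rintro r _ ⟨x, hx, rfl⟩
    obtain ⟨r, rfl⟩ := residue_surjective r
    exact ⟨r • x, N.smul_mem r hx, h.map_smul_eq r x⟩

lemma commutatorSpan_le (h : IsReduction ϖ ρ) :
    commutatorSpan (ResidueField O) B ≤ h.mapSubmodule (commutatorSpan O S) := by
  rw [commutatorSpan, Submodule.span_le]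
  rintro _ ⟨s, t, rfl⟩
  obtain ⟨s, rfl⟩ := h.surjective s
  obtain ⟨t, rfl⟩ := h.surjective t
  exact ⟨s * t - t * s, mul_sub_mul_mem_commutatorSpan s t, by simp⟩

/-- Nakayama's lemma: a submodule whose reduction contains the reduction of `N` contains `N`. -/
lemma le_of_forall_exists_sub_eq_smul [Module.Finite O S] (h : IsReduction ϖ ρ)
    {N N' : Submodule O S} (hN : ∀ x ∈ N, ∃ y ∈ N', ∃ w ∈ N, x - y = ϖ • w) : N ≤ N' := by
  have : IsNoetherian O S := isNoetherian_of_isNoetherianRing_of_finite O S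
  refine Submodule.le_of_le_smul_of_le_jacobson_bot (I := maximalIdeal O)
    (IsNoetherian.noetherian N) (maximalIdeal_le_jacobson ⊥) fun x hx ↦ ?_
  obtain ⟨y, hy, w, hw, hxy⟩ := hN x hx
  rw [← sub_add_cancel x y, hxy, add_comm]
  refine add_mem (Submodule.mem_sup_left hy) (Submodule.mem_sup_right ?_)
  refine Submodule.smul_mem_smul ?_ hw
  rw [h.irreducible.maximalIdeal_eq]
  exact Ideal.mem_span_singleton_self ϖ

/-- A complete system of orthogonal idempotents indexed by `Fin 3` lifts. -/
lemma exists_orthogonal_lift [IsAdicComplete (maximalIdeal O) O] [Module.Finite O S]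
    [Module.Free O S] (h : IsReduction ϖ ρ) (e : Fin 3 → B) (he : ∀ v, e v * e v = e v)
    (hne : ∀ u v, u ≠ v → e u * e v = 0) (hsum : e 0 + e 1 + e 2 = 1) :
    ∃ f : Fin 3 → S, (∀ v, f v * f v = f v) ∧ (∀ u v, u ≠ v → f u * f v = 0) ∧
      f 0 + f 1 + f 2 = 1 ∧ ∀ v, ρ (f v) = e v := by
  have lift : ∀ y : S, ρ y * ρ y = ρ y → ∃ f : S, f * f = f ∧ ρ f = ρ y ∧
      (∀ g, g * y = 0 → g * f = 0) ∧ (∀ g, y * g = 0 → f * g = 0) := by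
    intro y hy
    obtain ⟨f, hf, ⟨w, hw⟩, h1, h2⟩ := exists_idempotent_lift h.irreducible y
      (h.exists_sub_eq_smul (by rw [map_mul, hy]))
    refine ⟨f, hf, ?_, h1, h2⟩
    rw [← sub_eq_zero, ← map_sub, hw, h.map_eq_zero]
  obtain ⟨y₀, hy₀⟩ := h.surjective (e 0)
  obtain ⟨f₀, hf₀, hr₀, -, -⟩ := lift y₀ (by rw [hy₀, he])
  rw [hy₀] at hr₀
  obtain ⟨y₁, hy₁⟩ := h.surjective (e 1)
  -- Cutting `y₁` down to the corner of `1 - f₀` makes `f₀` annihilate it on both sides. The lift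
  -- inherits this, so it is orthogonal to `f₀` exactly and not just modulo the uniformizer.
  have hy : ρ ((1 - f₀) * y₁ * (1 - f₀)) = e 1 := by
    simp [hr₀, hy₁, sub_mul, mul_sub, hne 0 1 (by decide), hne 1 0 (by decide)]
  obtain ⟨f₁, hf₁, hr₁, hl, hr⟩ := lift ((1 - f₀) * y₁ * (1 - f₀)) (by rw [hy, he])
  rw [hy] at hr₁
  have h01 : f₀ * f₁ = 0 := hl f₀ (by
    rw [← mul_assoc, ← mul_assoc, mul_sub f₀, mul_one, hf₀]; simp)
  have h10 : f₁ * f₀ = 0 := hr f₀ (by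
    rw [mul_assoc, sub_mul 1 f₀ f₀, one_mul, hf₀]; simp)
  refine ⟨![f₀, f₁, 1 - f₀ - f₁], ?_, ?_, ?_, ?_⟩
  · intro v
    fin_cases v
    · exact hf₀
    · exact hf₁
    · simp [sub_mul, mul_sub, hf₀, hf₁, h01, h10]
  · intro u v huv
    fin_cases u <;> fin_cases v <;>
      first
      | exact absurd rfl huv
      | simp [sub_mul, mul_sub, hf₀, hf₁, h01, h10]
  · simp
  · intro v
    fin_cases v
    · exact hr₀
    · exact hr₁
    · simp only [Fin.reduceFinMk, Matrix.cons_val, map_sub, map_one, hr₀, hr₁, ← hsum]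
      abel

end General

variable [Module.Finite O S] {c : ℕ}
variable {ρ : S →+* Q3K (ResidueField O) c}

section Classes

variable {K : Type*} [Field K] [Algebra O K] [IsFractionRing O K] {ι : Type*} [Fintype ι]
  (h : IsReduction ϖ ρ) (hc : 2 ≤ c) (hcard : Fintype.card ι = c + 5)
  (χ : S →ₗ[O] (ι → K)) (hχ : ∀ x y, χ (x * y) = χ (y * x))
  (hspan : Submodule.span K (Set.range χ) = ⊤)
  {r : Fin 3 ⊕ Fin 2 ⊕ Fin c → S} (hr : ∀ i, ρ (r i) = classRep (ResidueField O) c i)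

include h hc hr in
-- Commutators lift to commutators, so the spanning family of the reduction modulo commutators lifts
-- by Nakayama.
lemma span_sup_commutatorSpan : Submodule.span O (Set.range r) ⊔ commutatorSpan O S = ⊤ := by
  rw [eq_top_iff]
  refine h.le_of_forall_exists_sub_eq_smul fun x _ ↦ ?_
  have key : classSpan (ResidueField O) c ≤
      h.mapSubmodule (Submodule.span O (Set.range r) ⊔ commutatorSpan O S) := by
    rw [classSpan]
    refine sup_le ?_ ?_
    · rw [Submodule.span_le]
      rintro _ ⟨i, rfl⟩
      exact ⟨r i, Submodule.mem_sup_left (Submodule.subset_span (Set.mem_range_self i)), hr i⟩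
    · rintro b hb
      obtain ⟨x, hx, rfl⟩ := h.commutatorSpan_le hb
      exact ⟨x, Submodule.mem_sup_right hx, rfl⟩
  have hx : ρ x ∈ classSpan (ResidueField O) c := by rw [classSpan_eq_top hc]; trivial
  obtain ⟨y, hy, hxy⟩ := key hx
  obtain ⟨w, hw⟩ := h.exists_sub_eq_smul hxy.symm
  exact ⟨y, hy, w, Submodule.mem_top, hw⟩

omit [Module.Finite O S] [IsDomain O] [IsDiscreteValuationRing O] [IsFractionRing O K] [Fintype ι] in
include hχ in
lemma commutatorSpan_le_ker : commutatorSpan O S ≤ LinearMap.ker χ := by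
  rw [commutatorSpan, Submodule.span_le]
  rintro _ ⟨s, t, rfl⟩
  simp [hχ s t]

include h hc hr in
lemma exists_sub_sum_mem (s : S) : ∃ x : Fin 3 ⊕ Fin 2 ⊕ Fin c → O,
    s - ∑ i, x i • r i ∈ commutatorSpan O S := by
  have hs : s ∈ Submodule.span O (Set.range r) ⊔ commutatorSpan O S := by
    rw [h.span_sup_commutatorSpan hc hr]; trivial
  obtain ⟨y, hy, w, hw, rfl⟩ := Submodule.mem_sup.1 hs
  obtain ⟨x, rfl⟩ := (Submodule.mem_span_range_iff_exists_fun O).1 hy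
  exact ⟨x, by simpa using hw⟩

include h hc hr hχ hspan hcard in
-- The map `χ` kills commutators, so the images of the c + 5 representatives span K^ι. This space
-- has dimension c + 5, hence they form a basis. Consequently the cocentre is free on the
-- representatives.
lemma linearIndependent_map : LinearIndependent O fun i ↦ χ (r i) := by
  rw [LinearIndependent.iff_fractionRing (R := O) (K := K)]
  refine linearIndependent_of_top_le_span_of_card_eq_finrank ?_ ?_
  · rw [← hspan, Submodule.span_le]
    rintro _ ⟨s, rfl⟩
    obtain ⟨x, hx⟩ := h.exists_sub_sum_mem hc hr s
    have := commutatorSpan_le_ker χ hχ hx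
    rw [LinearMap.mem_ker, map_sub, sub_eq_zero] at this
    rw [this, map_sum]
    refine sum_mem fun i _ ↦ ?_
    rw [map_smul, ← algebraMap_smul K (x i)]
    exact Submodule.smul_mem _ _ (Submodule.subset_span ⟨i, rfl⟩)
  · simp [hcard]; omega

include h hc hr hχ hspan hcard in
lemma eq_zero_of_sum_mem {x : Fin 3 ⊕ Fin 2 ⊕ Fin c → O}
    (hx : ∑ i, x i • r i ∈ commutatorSpan O S) : x = 0 := by
  have := commutatorSpan_le_ker χ hχ hx
  rw [LinearMap.mem_ker, map_sum] at this
  simp only [map_smul] at this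
  exact funext (Fintype.linearIndependent_iff.1
    (h.linearIndependent_map hc hcard χ hχ hspan hr) x this)

include h hc hχ hspan hcard in
/-- No member of `classRep` lies in the span of the commutators. -/
lemma classRep_notMem (i : Fin 3 ⊕ Fin 2 ⊕ Fin c) :
    classRep (ResidueField O) c i ∉ commutatorSpan (ResidueField O) (Q3K (ResidueField O) c) := by
  classical
  choose r hr using fun i ↦ h.surjective (classRep (ResidueField O) c i)
  intro hi
  obtain ⟨w, hw, hwi⟩ := h.commutatorSpan_le hi
  obtain ⟨s, hs⟩ := h.exists_sub_eq_smul ((hr i).trans hwi.symm)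
  obtain ⟨x, hx⟩ := h.exists_sub_sum_mem hc hr s
  -- If the i-th class vanished in the reduction, `r i` would be a commutator sum plus `ϖ • s`.
  -- Expanding `s` in the representatives gives a relation with i-th coefficient `1 - ϖ * x i`;
  -- freeness makes it zero and `ϖ` a unit.
  have hmem : ∑ j, ((Pi.single i 1 : Fin 3 ⊕ Fin 2 ⊕ Fin c → O) - ϖ • x) j • r j ∈
      commutatorSpan O S := by
    have : ∑ j, ((Pi.single i 1 : Fin 3 ⊕ Fin 2 ⊕ Fin c → O) - ϖ • x) j • r j =
        w + ϖ • (s - ∑ j, x j • r j) := by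
      rw [smul_sub, ← hs]
      simp [sub_smul, mul_smul, Finset.smul_sum, Pi.single_apply, ite_smul, -Fintype.sum_sum_type]
      abel
    rw [this]
    exact add_mem hw (Submodule.smul_mem _ _ hx)
  have h0 := congrFun (h.eq_zero_of_sum_mem hc hcard χ hχ hspan hr hmem) i
  simp only [Pi.sub_apply, Pi.single_eq_same, Pi.smul_apply, smul_eq_mul, Pi.zero_apply,
    sub_eq_zero] at h0
  exact h.irreducible.not_isUnit (IsUnit.of_mul_eq_one _ h0.symm)

include h hc hχ hspan hcard in
/-- Central elements lift from the reduction of a symmetric algebra if the quotient by the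
commutators is free. -/
theorem exists_center_lift (hsymm : IsSymmetricAlg O S) {b : Q3K (ResidueField O) c}
    (hb : b ∈ Subalgebra.center (ResidueField O) (Q3K (ResidueField O) c)) :
    ∃ z ∈ Subalgebra.center O S, ρ z = b := by
  classical
  obtain ⟨-, -, t, ht, hbij⟩ := hsymm
  have hinj : ∀ x y : S, (∀ s, t (x * s) = t (y * s)) → x = y := fun x y hxy ↦
    hbij.1 (LinearMap.ext hxy)
  have hsurj : ∀ g : S →ₗ[O] O, ∃ x, ∀ s, t (x * s) = g s := fun g ↦ by
    obtain ⟨x, hx⟩ := hbij.2 g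
    exact ⟨x, fun s ↦ LinearMap.congr_fun hx s⟩
  choose r hr using fun i ↦ h.surjective (classRep (ResidueField O) c i)
  obtain ⟨y, rfl⟩ := h.surjective b
  let W := commutatorSpan O S
  let Φ : (Fin 3 ⊕ Fin 2 ⊕ Fin c → O) →ₗ[O] S ⧸ W :=
    W.mkQ ∘ₗ Fintype.linearCombination O r
  have hΦ : Function.Bijective Φ := by
    constructor
    · rw [← LinearMap.ker_eq_bot, LinearMap.ker_eq_bot']
      intro x hx
      refine h.eq_zero_of_sum_mem hc hcard χ hχ hspan hr ?_
      simpa only [Φ, LinearMap.comp_apply, Fintype.linearCombination_apply,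
        Submodule.mkQ_apply, Submodule.Quotient.mk_eq_zero] using hx
    · intro q
      obtain ⟨s, rfl⟩ := W.mkQ_surjective q
      obtain ⟨x, hx⟩ := h.exists_sub_sum_mem hc hr s
      refine ⟨x, ?_⟩
      symm
      simpa only [Φ, LinearMap.comp_apply, Fintype.linearCombination_apply,
        Submodule.mkQ_apply, Submodule.Quotient.eq] using hx
  let E := LinearEquiv.ofBijective Φ hΦ
  let g₀ : (Fin 3 ⊕ Fin 2 ⊕ Fin c → O) →ₗ[O] O :=
    Fintype.linearCombination O fun i ↦ t (y * r i)
  -- The functional `t (y * ·)` is corrected to one that kills commutators exactly: the values on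
  -- the representatives are kept and extended through the free cocentre.
  let g : S →ₗ[O] O := g₀ ∘ₗ E.symm.toLinearMap ∘ₗ W.mkQ
  have hgW : ∀ w ∈ W, g w = 0 := by
    intro w hw
    have : W.mkQ w = 0 := by simpa using hw
    simp only [g, LinearMap.comp_apply, this, map_zero]
  -- As `y` is central modulo `ϖ`, the identity t(y(su - us)) = t((ys - sy)u) puts the value in `ϖ
  -- O`. So the correction is zero modulo `ϖ`.
  have htW : ∀ w ∈ W, ∃ o : O, t (y * w) = ϖ * o := by
    intro w hw
    induction hw using Submodule.span_induction with
    | mem w hw =>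
      obtain ⟨s, u, rfl⟩ := hw
      have hys : ρ (y * s) = ρ (s * y) := by
        rw [map_mul, map_mul, Subalgebra.mem_center_iff.1 hb]
      obtain ⟨v, hv⟩ := h.exists_sub_eq_smul hys
      refine ⟨t (v * u), ?_⟩
      rw [← smul_eq_mul ϖ, ← map_smul, ← smul_mul_assoc, ← hv, mul_sub, sub_mul, map_sub, map_sub,
        ← mul_assoc y u, ht (y * u) s, mul_assoc y s, mul_assoc s y]
    | zero => exact ⟨0, by simp⟩
    | add v w _ _ hv hw =>
      obtain ⟨o, ho⟩ := hv
      obtain ⟨o', ho'⟩ := hw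
      exact ⟨o + o', by rw [mul_add, map_add, ho, ho', mul_add]⟩
    | smul a w _ hw =>
      obtain ⟨o, ho⟩ := hw
      exact ⟨a * o, by rw [mul_smul_comm, map_smul, ho, smul_eq_mul]; ring⟩
  have hg : ∀ s, ∃ o : O, g s - t (y * s) = ϖ * o := by
    intro s
    obtain ⟨x, hx⟩ := h.exists_sub_sum_mem hc hr s
    have hgs : g s = t (y * ∑ i, x i • r i) := by
      have h1 : g s = g (∑ i, x i • r i) := by
        rw [← sub_eq_zero, ← map_sub]; exact hgW _ hx
      have h2 : W.mkQ (∑ i, x i • r i) = E x := rfl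
      rw [h1]
      simp only [g, LinearMap.comp_apply, h2, LinearEquiv.coe_coe, E.symm_apply_apply]
      simp [g₀, Fintype.linearCombination_apply, Finset.mul_sum, -Fintype.sum_sum_type]
    obtain ⟨o, ho⟩ := htW _ hx
    refine ⟨-o, ?_⟩
    rw [hgs, mul_neg, ← ho, mul_sub, map_sub]; ring
  -- The element representing `g` is central because `g` kills commutators. Dividing `g - t (y * ·)`
  -- by `ϖ` and representing the quotient shows that it is congruent to `y`.
  obtain ⟨z, hz⟩ := hsurj g
  refine ⟨z, ?_, ?_⟩
  · rw [Subalgebra.mem_center_iff]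
    intro s
    refine hinj _ _ fun u ↦ ?_
    have := hgW _ (mul_sub_mul_mem_commutatorSpan u s)
    rw [← hz, mul_sub, map_sub, sub_eq_zero] at this
    rw [mul_assoc, ht s, mul_assoc, mul_assoc, this]
  · have : ∃ w, z - y = ϖ • w := by
      choose o ho using hg
      let q : S →ₗ[O] O :=
        { toFun := o
          map_add' := fun a b ↦ by
            refine mul_left_cancel₀ h.irreducible.ne_zero ?_
            rw [mul_add, ← ho, ← ho, ← ho, mul_add, map_add, map_add]; ring
          map_smul' := fun a b ↦ by
            refine mul_left_cancel₀ h.irreducible.ne_zero ?_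
            rw [← ho, mul_smul_comm, map_smul, map_smul, RingHom.id_apply, smul_eq_mul,
              smul_eq_mul, smul_eq_mul, mul_left_comm, ← ho]; ring }
      obtain ⟨w, hw⟩ := hsurj q
      refine ⟨w, hinj _ _ fun s ↦ ?_⟩
      rw [sub_mul, map_sub, hz, ho, smul_mul_assoc, map_smul, hw, smul_eq_mul]
      rfl
    obtain ⟨w, hw⟩ := this
    rw [← sub_eq_zero, ← map_sub, hw, h.map_eq_zero]

end Classes

end IsReduction

/-! ### Peirce systems of orders. -/

/-- A homomorphism between left ideals generated by idempotents is right multiplication by the image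
of the generating idempotent; `x` and `y` are these images for the isomorphism and its inverse. -/
lemma exists_mul_eq_of_span_equiv {S : Type*} [Ring S] {e f : S} (he : e * e = e) (hf : f * f = f)
    (θ : Ideal.span {e} ≃ₗ[S] Ideal.span {f}) :
    ∃ x y : S, e * x = x ∧ x * f = x ∧ f * y = y ∧ y * e = y ∧ x * y = e ∧ y * x = f := by
  have mem : ∀ {g x : S}, g * g = g → x ∈ Ideal.span {g} → x * g = x := by
    intro g x hg hx
    obtain ⟨a, rfl⟩ := Ideal.mem_span_singleton'.1 hx
    rw [mul_assoc, hg]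
  let e' : Ideal.span {e} := ⟨e, Ideal.mem_span_singleton_self e⟩
  let f' : Ideal.span {f} := ⟨f, Ideal.mem_span_singleton_self f⟩
  have he' : e • e' = e' := Subtype.ext he
  have hf' : f • f' = f' := Subtype.ext hf
  have hx : (θ e' : S) * f = θ e' := mem hf (θ e').2
  have hxe : (θ e' : S) • f' = θ e' := Subtype.ext hx
  have hye : (θ.symm f' : S) • e' = θ.symm f' := Subtype.ext (mem he (θ.symm f').2)
  refine ⟨θ e', θ.symm f', ?_, hx, ?_, mem he (θ.symm f').2, ?_, ?_⟩
  · have := congrArg Subtype.val (map_smul θ e e')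
    rw [he'] at this
    exact this.symm
  · have := congrArg Subtype.val (map_smul θ.symm f f')
    rw [hf'] at this
    exact this.symm
  · have := congrArg Subtype.val (map_smul θ.symm (θ e' : S) f')
    rw [hxe, θ.symm_apply_apply] at this
    exact this.symm
  · have := congrArg Subtype.val (map_smul θ (θ.symm f' : S) e')
    rw [hye, θ.apply_symm_apply] at this
    exact this.symm

/-- A complete system of orthogonal primitive idempotents of `S` with pairwise non-isomorphic
projective modules, whose Peirce components are cyclic over the centre of `S`, and such that the
product of the generators of consecutive components is not divisible by `ϖ`. -/
structure PeirceSystem {O : Type*} (S : Type*) [CommRing O] [Ring S] [Algebra O S] (ϖ : O)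
    (x : Fin 3 → Fin 3 → S) : Prop where
  idem_mul_idem_of_ne : ∀ u v, u ≠ v → x u u * x v v = 0
  sum_idem : ∑ v, x v v = 1
  primitive : ∀ v, IsPrimitiveIdempotent (x v v)
  eq_of_equiv : ∀ u v, Nonempty (Ideal.span {x u u} ≃ₗ[S] Ideal.span {x v v}) → u = v
  idem_mul : ∀ u v, x u u * x u v = x u v
  mul_idem : ∀ u v, x u v * x v v = x u v
  exists_center : ∀ u v s, ∃ z ∈ Subalgebra.center O S, x u u * s * x v v = z * x u v
  mul_ne_smul : ∀ u v w, u ≠ v → v ≠ w → u ≠ w → ∀ s, x u v * x v w ≠ ϖ • s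

lemma PeirceSystem.reindex {O S : Type*} [CommRing O] [Ring S] [Algebra O S] {ϖ : O}
    {x : Fin 3 → Fin 3 → S} (h : PeirceSystem S ϖ x) (σ : Equiv.Perm (Fin 3)) :
    PeirceSystem S ϖ fun u v ↦ x (σ u) (σ v) where
  idem_mul_idem_of_ne u v huv := h.idem_mul_idem_of_ne _ _ (σ.injective.ne huv)
  sum_idem := by rw [← h.sum_idem]; exact Equiv.sum_comp σ fun v ↦ x v v
  primitive v := h.primitive _
  eq_of_equiv u v huv := σ.injective (h.eq_of_equiv _ _ huv)
  idem_mul u v := h.idem_mul _ _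
  mul_idem u v := h.mul_idem _ _
  exists_center u v s := h.exists_center _ _ s
  mul_ne_smul u v w huv hvw huw :=
    h.mul_ne_smul _ _ _ (σ.injective.ne huv) (σ.injective.ne hvw) (σ.injective.ne huw)

namespace IsReduction

open IsLocalRing Q3K

variable {O : Type*} [CommRing O] [IsDomain O] [IsDiscreteValuationRing O] {ϖ : O}
variable {S : Type*} [Ring S] [Algebra O S] [Module.Finite O S] {c : ℕ}
variable {ρ : S →+* Q3K (ResidueField O) c}

/-- The Peirce decomposition of a symmetric order which reduces to `Q3K`. -/
theorem exists_peirceSystem [IsAdicComplete (maximalIdeal O) O] [Module.Free O S]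
    {K : Type*} [Field K] [Algebra O K] [IsFractionRing O K] {ι : Type*} [Fintype ι]
    (h : IsReduction ϖ ρ) (hc : 2 ≤ c) (hcard : Fintype.card ι = c + 5)
    (χ : S →ₗ[O] (ι → K)) (hχ : ∀ x y, χ (x * y) = χ (y * x))
    (hspan : Submodule.span K (Set.range χ) = ⊤) (hsymm : IsSymmetricAlg O S) :
    ∃ x : Fin 3 → Fin 3 → S, PeirceSystem S ϖ x := by
  obtain ⟨f, hff, hfne, hfsum, hρf⟩ := h.exists_orthogonal_lift
    (fun v ↦ arrow (ResidueField O) c v v) idem_mul_idem (fun _ _ ↦ idem_mul_idem_of_ne) idem_sum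
  choose y hy using fun u v ↦ h.surjective (arrow (ResidueField O) c u v)
  let x : Fin 3 → Fin 3 → S := fun u v ↦ if u = v then f u else f u * y u v * f v
  have hxx : ∀ v, x v v = f v := fun v ↦ if_pos rfl
  have hl : ∀ u v, f u * x u v = x u v := by
    intro u v
    by_cases huv : u = v
    · subst huv; rw [hxx, hff]
    · simp only [x, if_neg huv, ← mul_assoc, hff]
  have hr : ∀ u v, x u v * f v = x u v := by
    intro u v
    by_cases huv : u = v
    · subst huv; rw [hxx, hff]
    · simp only [x, if_neg huv, mul_assoc, hff]
  have hρx : ∀ u v, ρ (x u v) = arrow (ResidueField O) c u v := by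
    intro u v
    by_cases huv : u = v
    · subst huv; rw [hxx, hρf]
    · simp only [x, if_neg huv, map_mul, hρf, hy, idem_mul_arrow, arrow_mul_idem]
  have hne : ∀ v, arrow (ResidueField O) c v v ≠ 0 := by
    intro v hv
    refine h.classRep_notMem hc hcard χ hχ hspan (Sum.inl v) ?_
    have : classRep (ResidueField O) c (Sum.inl v) = 0 := hv
    rw [this]; exact zero_mem _
  refine ⟨x, ⟨?_, ?_, ?_, ?_, ?_, ?_, ?_, ?_⟩⟩
  · intro u v huv; rw [hxx, hxx, hfne u v huv]
  · simp only [hxx, Fin.sum_univ_three, hfsum]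
  · intro v
    rw [hxx]
    refine ⟨hff v, ?_, ?_⟩
    · intro h0
      exact hne v (by rw [← hρf v, h0, map_zero])
    · intro g hg h1 h2
      rcases idempotent_eq_zero_or_eq (v := v) hc (f := ρ g) (by rw [← map_mul, hg.eq])
        (by rw [← hρf, ← map_mul, h1]) (by rw [← hρf, ← map_mul, h2]) with h0 | h0
      · exact Or.inl (h.idempotent_eq_zero hg.eq h0)
      · right
        have : f v - g = 0 := h.idempotent_eq_zero
          (by rw [sub_mul, mul_sub, mul_sub, hff, h1, h2, hg.eq, sub_self, sub_zero])
          (by rw [map_sub, h0]; exact sub_eq_zero.2 (hρf v))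
        exact (sub_eq_zero.1 this).symm
  · rintro u v ⟨θ⟩
    by_contra huv
    rw [hxx, hxx] at θ
    obtain ⟨p, q, hp1, hp2, hq1, hq2, hpq, -⟩ := exists_mul_eq_of_span_equiv (hff u) (hff v) θ
    obtain ⟨s, hs, hsp⟩ := exists_idem_mul_mul_idem_eq hc (ρ p) u v
    obtain ⟨t, ht, htq⟩ := exists_idem_mul_mul_idem_eq hc (ρ q) v u
    rw [← hρf, ← hρf, ← map_mul, ← map_mul, hp1, hp2] at hsp
    rw [← hρf, ← hρf, ← map_mul, ← map_mul, hq1, hq2] at htq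
    have hz := cyc_mem_cycAlgebra (k := ResidueField O) (c := c) huv
    -- An isomorphism would factor the idempotent at `u` through the vertex `v`, making it a
    -- multiple of the nilpotent cycle sum times itself.
    have key : arrow (ResidueField O) c u u =
        s * t * cyc (ResidueField O) c u v * arrow (ResidueField O) c u u := by
      nth_rewrite 1 [← hρf u]
      rw [← hpq, map_mul, hsp, htq, mul_assoc, ← mul_assoc (arrow _ _ u v),
        cycAlgebra_comm hc ht, mul_assoc t, mul_assoc _ _ (arrow _ _ u u), cyc_mul_idem_left huv,
        mul_assoc]
    obtain ⟨m, hm⟩ : IsNilpotent (s * t * cyc (ResidueField O) c u v) :=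
      Commute.isNilpotent_mul_left (cycAlgebra_comm hc hz _) (isNilpotent_cyc hc huv)
    have hpow : ∀ m : ℕ, (s * t * cyc (ResidueField O) c u v) ^ m *
        arrow (ResidueField O) c u u = arrow (ResidueField O) c u u := by
      intro m
      induction m with
      | zero => rw [pow_zero, one_mul]
      | succ m ih => rw [pow_succ, mul_assoc, ← key, ih]
    exact hne u (by rw [← hpow m, hm, zero_mul])
  · intro u v; rw [hxx, hl]
  · intro u v; rw [hxx, hr]
  · intro u v
    let N : Submodule O S :=
      LinearMap.range (LinearMap.mulLeft O (f u) ∘ₗ LinearMap.mulRight O (f v))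
    let N' : Submodule O S :=
      (Subalgebra.toSubmodule (Subalgebra.center O S)).map (LinearMap.mulRight O (x u v))
    -- Nakayama for the Peirce component: modulo `ϖ` it is generated by the arrow over central
    -- elements, and those lift to the centre of `S`. The remainder is cut back into the component.
    have hle : N ≤ N' := by
      refine h.le_of_forall_exists_sub_eq_smul ?_
      rintro _ ⟨s, rfl⟩
      obtain ⟨b, hb, hbs⟩ := exists_idem_mul_mul_idem_eq hc (ρ s) u v
      obtain ⟨z, hz, rfl⟩ := h.exists_center_lift hc hcard χ hχ hspan hsymm
        (cycAlgebra_le_center hc hb)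
      obtain ⟨w, hw⟩ := h.exists_sub_eq_smul (s := f u * s * f v) (s' := z * x u v)
        (by rw [map_mul, map_mul, hρf, hρf, hbs, map_mul, hρx])
      refine ⟨z * x u v, ⟨z, hz, rfl⟩, f u * (w * f v), ⟨w, rfl⟩, ?_⟩
      have hzc := Subalgebra.mem_center_iff.1 hz
      have h1 : f u * (z * x u v) * f v = z * x u v := by
        rw [← mul_assoc, hzc, mul_assoc z, hl, mul_assoc, hr]
      have h2 : f u * (f u * s * f v) * f v = f u * s * f v := by
        rw [mul_assoc, mul_assoc _ (f v), hff, ← mul_assoc, ← mul_assoc, hff]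
      have := congrArg (fun t ↦ f u * t * f v) hw
      simp only [mul_sub, sub_mul, h1, h2] at this
      simp only [LinearMap.comp_apply, LinearMap.mulLeft_apply, LinearMap.mulRight_apply]
      rw [← mul_assoc, this]
      simp [mul_assoc]
    intro s
    obtain ⟨z, hz, hzs⟩ := hle ⟨s, rfl⟩
    refine ⟨z, hz, ?_⟩
    rw [hxx, hxx, mul_assoc]
    exact hzs.symm
  · intro u v w huv hvw huw s hs
    -- Divisibility would make the whole oriented triangle zero in the reduction, but its class
    -- modulo commutators is that of a representative, which is nonzero.
    have h0 : arrow (ResidueField O) c u v * arrow (ResidueField O) c v w = 0 := by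
      rw [← hρx, ← hρx, ← map_mul, hs, h.map_eq_zero]
    have := triangle_sub_mem (k := ResidueField O) hc huv hvw huw
    rw [h0, zero_mul, zero_sub, neg_mem_iff] at this
    exact h.classRep_notMem hc hcard χ hχ hspan _ this

end IsReduction

/-! ### Numerical Peirce data and their comparison up to diagonal rescaling. -/

section PeirceData

variable {O K : Type*} [CommRing O] [Field K] [Algebra O K] {ι : Type*}

/-- The `Z`-multiples of the vector `ξ`, where only coordinates in `s` matter. -/
def cyclicSet (Z : Subalgebra O (ι → K)) (s : Set ι) (ξ : ι → K) : Set (ι → K) :=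
  {y | ∃ ζ ∈ Z, ∀ i ∈ s, y i = ζ i * ξ i}

variable [Fintype ι]

open Classical in
/-- The pairing of vectors with weights `u`, restricted to the coordinates in `s`. -/
noncomputable def weightedPairing (u : ι → K) (s : Set ι) (x y : ι → K) : K :=
  ∑ i, if i ∈ s then u i * x i * y i else 0

/-- Numerical description of a symmetric order: with `s j` the set of components in which the
`j`-th idempotent is nonzero, the Peirce component `(j, j')` consists of the `Z`-multiples of
`ξ j j'`, opposite components are dual for the weights `u`, and the product of the generators `ξ 0 1`
and `ξ 1 2` is in the component `(0, 2)`, but is not divisible by `ϖ` there. -/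
structure PeirceData (Z : Subalgebra O (ι → K)) (s : Fin 3 → Set ι) (ϖ : O)
    (ξ : Fin 3 → Fin 3 → ι → K) (u : ι → K) : Prop where
  gen_self : ∀ j, ∀ i ∈ s j, ξ j j i = 1
  gen_ne_zero : ∀ j j', ∀ i ∈ s j ∩ s j', ξ j j' i ≠ 0
  weight_ne_zero : ∀ i, u i ≠ 0
  dual : ∀ j j' y, y ∈ cyclicSet Z (s j' ∩ s j) (ξ j' j) ↔
    ∀ x ∈ cyclicSet Z (s j ∩ s j') (ξ j j'),
      weightedPairing u (s j ∩ s j') x y ∈ (algebraMap O K).range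
  exists_mul : ∃ ζ ∈ Z, (∀ i ∈ s 0 ∩ s 2, i ∈ s 1 → ξ 0 1 i * ξ 1 2 i = ζ i * ξ 0 2 i) ∧
    ∀ i ∈ s 0 ∩ s 2, i ∉ s 1 → ζ i = 0
  mul_ne_smul : ∀ ζ ∈ Z, (∀ i ∈ s 0 ∩ s 2, i ∈ s 1 →
    ξ 0 1 i * ξ 1 2 i = algebraMap O K ϖ * (ζ i * ξ 0 2 i)) → ¬ ∀ i ∈ s 0 ∩ s 2, i ∉ s 1 → ζ i = 0

namespace PeirceData

variable {Z : Subalgebra O (ι → K)} {s : Fin 3 → Set ι} {ϖ : O}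
  {ξ ξ' : Fin 3 → Fin 3 → ι → K} {u u' : ι → K}

omit [Fintype ι] in
lemma mul_mem_cyclicSet {σ : Set ι} {ξ : ι → K} {w y : ι → K} (hw : w ∈ Z)
    (hy : y ∈ cyclicSet Z σ ξ) : w * y ∈ cyclicSet Z σ ξ := by
  obtain ⟨ζ, hζ, hy⟩ := hy
  exact ⟨w * ζ, mul_mem hw hζ, fun i hi ↦ by rw [Pi.mul_apply, hy i hi, Pi.mul_apply, mul_assoc]⟩

lemma weightedPairing_congr {σ : Set ι} {u u' x x' y y' : ι → K}
    (h : ∀ i ∈ σ, u i * x i * y i = u' i * x' i * y' i) :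
    weightedPairing u σ x y = weightedPairing u' σ x' y' := by
  refine Finset.sum_congr rfl fun i _ ↦ ?_
  split_ifs with hi
  · exact h i hi
  · rfl

/-- The weights of two systems with the same `Z` differ by an element of `Z`
on the support of each idempotent. -/
lemma exists_weight_eq (h : PeirceData Z s ϖ ξ u) (h' : PeirceData Z s ϖ ξ' u') (j : Fin 3) :
    ∃ w ∈ Z, ∀ i ∈ s j, u' i = u i * w i := by
  -- The diagonal component is `Z` restricted to `s j` in both systems, and it is self-dual for
  -- either weight. Pairing `u' / u` by `u` is pairing 1 by `u'`, hence integral, so the quotient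
  -- lies in the dual, which is `Z` again.
  have key : (fun i ↦ u' i / u i) ∈ cyclicSet Z (s j ∩ s j) (ξ j j) := by
    rw [h.dual]
    rintro x ⟨ζ, hζ, hx⟩
    have h1 : (1 : ι → K) ∈ cyclicSet Z (s j ∩ s j) (ξ' j j) :=
      ⟨1, one_mem _, fun i hi ↦ by rw [h'.gen_self j i hi.1, mul_one]⟩
    rw [h'.dual] at h1
    convert h1 x ⟨ζ, hζ, fun i hi ↦ by
      rw [hx i hi, h.gen_self j i hi.1, h'.gen_self j i hi.1]⟩ using 1
    refine weightedPairing_congr fun i _ ↦ ?_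
    have := h.weight_ne_zero i
    rw [Pi.one_apply]
    field_simp
  obtain ⟨w, hw, hy⟩ := key
  refine ⟨w, hw, fun i hi ↦ ?_⟩
  have := hy i ⟨hi, hi⟩
  rw [h.gen_self j i hi, mul_one] at this
  rw [← this, mul_div_cancel₀ _ (h.weight_ne_zero i)]

lemma pairing_mem_of_weights (h : PeirceData Z s ϖ ξ u) (h' : PeirceData Z s ϖ ξ' u')
    {j j' : Fin 3} {y : ι → K}
    (hy : ∀ x ∈ cyclicSet Z (s j ∩ s j') (ξ j j'),
      weightedPairing u (s j ∩ s j') x y ∈ (algebraMap O K).range) :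
    ∀ x ∈ cyclicSet Z (s j ∩ s j') (ξ j j'),
      weightedPairing u' (s j ∩ s j') x y ∈ (algebraMap O K).range := by
  intro x hx
  obtain ⟨w, hw, hu⟩ := h.exists_weight_eq h' j
  convert hy (w * x) (mul_mem_cyclicSet hw hx) using 1
  refine weightedPairing_congr fun i hi ↦ ?_
  rw [hu i hi.1, Pi.mul_apply]; ring

/-- If the components `(j, j')` agree up to rescaling then so do the opposite components. -/
lemma mem_iff_of_opposite (h : PeirceData Z s ϖ ξ u) (h' : PeirceData Z s ϖ ξ' u') {j j' : Fin 3}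
    {a : ι → K} (ha : ∀ i, a i ≠ 0)
    (hjj : ∀ y, y ∈ cyclicSet Z (s j ∩ s j') (ξ j j') ↔
      a * y ∈ cyclicSet Z (s j ∩ s j') (ξ' j j')) (y : ι → K) :
    y ∈ cyclicSet Z (s j' ∩ s j) (ξ j' j) ↔
      a⁻¹ * y ∈ cyclicSet Z (s j' ∩ s j) (ξ' j' j) := by
  rw [h.dual, h'.dual]
  have key : (∀ x ∈ cyclicSet Z (s j ∩ s j') (ξ' j j'),
      weightedPairing u' (s j ∩ s j') x (a⁻¹ * y) ∈ (algebraMap O K).range) ↔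
      ∀ x ∈ cyclicSet Z (s j ∩ s j') (ξ j j'),
        weightedPairing u' (s j ∩ s j') x y ∈ (algebraMap O K).range := by
    constructor
    · intro H x hx
      convert H (a * x) ((hjj x).1 hx) using 1
      refine weightedPairing_congr fun i _ ↦ ?_
      have := ha i
      simp only [Pi.mul_apply, Pi.inv_apply]
      field_simp
    · intro H x hx
      have haa : a * (a⁻¹ * x) = x := by
        funext i
        simp [mul_inv_cancel_left₀ (ha i)]
      convert H (a⁻¹ * x) ((hjj _).2 (by rwa [haa])) using 1
      refine weightedPairing_congr fun i _ ↦ ?_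
      simp only [Pi.mul_apply, Pi.inv_apply]
      ring
  rw [key]
  refine ⟨h.pairing_mem_of_weights h', fun H x hx ↦ ?_⟩
  obtain ⟨w, hw, hu⟩ := h'.exists_weight_eq h j
  convert H (w * x) (mul_mem_cyclicSet hw hx) using 1
  refine weightedPairing_congr fun i hi ↦ ?_
  rw [hu i hi.1, Pi.mul_apply]; ring

omit [Fintype ι] in
-- Generators need to match only up to a unit of `O`, because such units act invertibly on `Z`. This
-- tolerance absorbs the discrepancy at the row (1,1,1).
lemma mem_cyclicSet_iff_of_unit {σ : Set ι} {ξ ξ' : ι → K} {a : ι → K} (ha : ∀ i, a i ≠ 0) (r : Oˣ)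
    (h : ∀ i ∈ σ, a i * ξ i = algebraMap O K r * ξ' i) (y : ι → K) :
    y ∈ cyclicSet Z σ ξ ↔ a * y ∈ cyclicSet Z σ ξ' := by
  constructor
  · rintro ⟨ζ, hζ, hy⟩
    refine ⟨(r : O) • ζ, Z.smul_mem hζ _, fun i hi ↦ ?_⟩
    rw [Pi.mul_apply, hy i hi, mul_left_comm, h i hi, Pi.smul_apply, Algebra.smul_def]
    ring
  · rintro ⟨ζ, hζ, hy⟩
    refine ⟨((r⁻¹ : Oˣ) : O) • ζ, Z.smul_mem hζ _, fun i hi ↦ ?_⟩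
    have hr : algebraMap O K ((r⁻¹ : Oˣ) : O) * algebraMap O K r = 1 := by
      rw [← map_mul, Units.inv_mul, map_one]
    refine mul_left_cancel₀ (ha i) ?_
    have h1 := hy i hi
    rw [Pi.mul_apply] at h1
    rw [Pi.smul_apply, Algebra.smul_def, h1, mul_left_comm (a i), h i hi]
    linear_combination (-ζ i * ξ' i) * hr

variable [IsDomain O] [IsDiscreteValuationRing O] [IsFractionRing O K]

omit [IsFractionRing O K] in
-- The product of the generators in the first system is given by some `ζ` in `Z`, which vanishes on
-- `s 0 ∩ s 2` away from `i₀`. If `o` were divisible by `ϖ`, a multiple of the same `ζ`, available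
-- in the common `Z`, would exhibit the product in the second system as divisible by `ϖ`.
lemma eq_unit_mul_of_eq_mul (hϖ : Irreducible ϖ) (h : PeirceData Z s ϖ ξ u)
    (h' : PeirceData Z s ϖ ξ' u') {i₀ : ι}
    (hi₀ : ∀ i, i ∈ s 0 → i ∈ s 1 → i ∈ s 2 → i = i₀) (hmem : i₀ ∈ s 0 ∧ i₀ ∈ s 1 ∧ i₀ ∈ s 2)
    {o : O} (ho : ξ' 0 1 i₀ * ξ' 1 2 i₀ * ξ 0 2 i₀ =
      algebraMap O K o * (ξ 0 1 i₀ * ξ 1 2 i₀ * ξ' 0 2 i₀)) : IsUnit o := by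
  by_contra hu
  have hmax : o ∈ IsLocalRing.maximalIdeal O := (IsLocalRing.mem_maximalIdeal o).2 hu
  rw [hϖ.maximalIdeal_eq, Ideal.mem_span_singleton] at hmax
  obtain ⟨o, rfl⟩ := hmax
  obtain ⟨ζ, hζ, h1, h2⟩ := h.exists_mul
  refine h'.mul_ne_smul (o • ζ) (Z.smul_mem hζ o) ?_ ?_
  · intro i hi hi1
    obtain rfl := hi₀ i hi.1 hi1 hi.2
    have hne := h.gen_ne_zero 0 2 i hi
    have h3 := h1 i hi hi1
    refine mul_right_cancel₀ hne ?_
    rw [ho, h3, Pi.smul_apply, Algebra.smul_def, map_mul]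
    ring
  · intro i hi hi1
    rw [Pi.smul_apply, h2 i hi hi1, smul_zero]

lemma exists_unit (hϖ : Irreducible ϖ) (h : PeirceData Z s ϖ ξ u)
    (h' : PeirceData Z s ϖ ξ' u') {i₀ : ι}
    (hi₀ : ∀ i, i ∈ s 0 → i ∈ s 1 → i ∈ s 2 → i = i₀)
    (hmem : i₀ ∈ s 0 ∧ i₀ ∈ s 1 ∧ i₀ ∈ s 2) :
    ∃ r : Oˣ, ξ' 0 1 i₀ * ξ' 1 2 i₀ * ξ 0 2 i₀ =
      algebraMap O K r * (ξ 0 1 i₀ * ξ 1 2 i₀ * ξ' 0 2 i₀) := by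
  obtain ⟨m0, m1, m2⟩ := hmem
  have n1 := h.gen_ne_zero 0 1 i₀ ⟨m0, m1⟩
  have n2 := h.gen_ne_zero 1 2 i₀ ⟨m1, m2⟩
  have n3 := h.gen_ne_zero 0 2 i₀ ⟨m0, m2⟩
  have n1' := h'.gen_ne_zero 0 1 i₀ ⟨m0, m1⟩
  have n2' := h'.gen_ne_zero 1 2 i₀ ⟨m1, m2⟩
  have n3' := h'.gen_ne_zero 0 2 i₀ ⟨m0, m2⟩
  -- Either the quotient of the two ratios or its inverse is integral. The previous lemma, applied
  -- in the fitting direction, shows that the integral one is a unit.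
  rcases ValuationRing.isInteger_or_isInteger O
    (ξ' 0 1 i₀ * ξ' 1 2 i₀ * ξ 0 2 i₀ / (ξ 0 1 i₀ * ξ 1 2 i₀ * ξ' 0 2 i₀)) with ⟨o, ho⟩ | ⟨o, ho⟩
  · have ho' : ξ' 0 1 i₀ * ξ' 1 2 i₀ * ξ 0 2 i₀ =
        algebraMap O K o * (ξ 0 1 i₀ * ξ 1 2 i₀ * ξ' 0 2 i₀) := by
      rw [ho]; field_simp
    exact ⟨(h.eq_unit_mul_of_eq_mul hϖ h' hi₀ ⟨m0, m1, m2⟩ ho').unit, ho'⟩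
  · have ho' : ξ 0 1 i₀ * ξ 1 2 i₀ * ξ' 0 2 i₀ =
        algebraMap O K o * (ξ' 0 1 i₀ * ξ' 1 2 i₀ * ξ 0 2 i₀) := by
      rw [ho]; field_simp
    obtain ⟨r, rfl⟩ := h'.eq_unit_mul_of_eq_mul hϖ h hi₀ ⟨m0, m1, m2⟩ ho'
    refine ⟨r⁻¹, ?_⟩
    rw [ho', ← mul_assoc, ← map_mul, Units.inv_mul, map_one, one_mul]

open Classical in
/-- Two systems with the same `Z` agree up to a diagonal rescaling if there is a unique component
in which all three idempotents are nonzero. -/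
theorem exists_rescaling (hϖ : Irreducible ϖ) (h : PeirceData Z s ϖ ξ u)
    (h' : PeirceData Z s ϖ ξ' u') {i₀ : ι}
    (hi₀ : ∀ i, i ∈ s 0 → i ∈ s 1 → i ∈ s 2 → i = i₀)
    (hmem : i₀ ∈ s 0 ∧ i₀ ∈ s 1 ∧ i₀ ∈ s 2) :
    ∃ t : Fin 3 → ι → K, (∀ j i, t j i ≠ 0) ∧ ∀ j j' y,
      y ∈ cyclicSet Z (s j ∩ s j') (ξ j j') ↔
        t j * (t j')⁻¹ * y ∈ cyclicSet Z (s j ∩ s j') (ξ' j j') := by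
  obtain ⟨r, hr⟩ := h.exists_unit hϖ h' hi₀ hmem
  have hr0 : algebraMap O K (r : O) ≠ 0 := (r.isUnit.map (algebraMap O K)).ne_zero
  let t1 : ι → K := fun i ↦ if i ∈ s 0 ∩ s 1 then ξ 0 1 i / ξ' 0 1 i else 1
  -- With `t 0 = 1`, `t1` matches the component (0,1) and the first case of `t2` matches (1,2).
  -- Where only idempotents 0 and 2 live, `t2` is still free; including `r` makes (0,2) match with
  -- the same unit factor as at `i₀`.
  let t2 : ι → K := fun i ↦ if i ∈ s 1 ∩ s 2 then t1 i * ξ 1 2 i / ξ' 1 2 i else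
    if i ∈ s 0 ∩ s 2 then ξ 0 2 i / (algebraMap O K r * ξ' 0 2 i) else 1
  have ht1 : ∀ i, t1 i ≠ 0 := by
    intro i
    simp only [t1]
    split_ifs with hi
    · exact div_ne_zero (h.gen_ne_zero _ _ i hi) (h'.gen_ne_zero _ _ i hi)
    · exact one_ne_zero
  have ht2 : ∀ i, t2 i ≠ 0 := by
    intro i
    simp only [t2]
    split_ifs with hi hi'
    · exact div_ne_zero (mul_ne_zero (ht1 i) (h.gen_ne_zero _ _ i hi)) (h'.gen_ne_zero _ _ i hi)
    · exact div_ne_zero (h.gen_ne_zero _ _ i hi') (mul_ne_zero hr0 (h'.gen_ne_zero _ _ i hi'))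
    · exact one_ne_zero
  let t : Fin 3 → ι → K := ![1, t1, t2]
  have ht : ∀ j i, t j i ≠ 0 := by
    intro j i
    fin_cases j
    exacts [one_ne_zero, ht1 i, ht2 i]
  have hquot : ∀ j j' i, (t j * (t j')⁻¹) i ≠ 0 := fun j j' i ↦
    mul_ne_zero (ht j i) (inv_ne_zero (ht j' i))
  have h01 : ∀ y, y ∈ cyclicSet Z (s 0 ∩ s 1) (ξ 0 1) ↔
      t 0 * (t 1)⁻¹ * y ∈ cyclicSet Z (s 0 ∩ s 1) (ξ' 0 1) := by
    refine mem_cyclicSet_iff_of_unit (hquot 0 1) 1 fun i hi ↦ ?_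
    have n1 := h.gen_ne_zero _ _ i hi
    have n2 := h'.gen_ne_zero _ _ i hi
    have : t1 i = ξ 0 1 i / ξ' 0 1 i := if_pos hi
    simp [t, this]
    field_simp
  have h12 : ∀ y, y ∈ cyclicSet Z (s 1 ∩ s 2) (ξ 1 2) ↔
      t 1 * (t 2)⁻¹ * y ∈ cyclicSet Z (s 1 ∩ s 2) (ξ' 1 2) := by
    refine mem_cyclicSet_iff_of_unit (hquot 1 2) 1 fun i hi ↦ ?_
    have n1 := h.gen_ne_zero _ _ i hi
    have n2 := h'.gen_ne_zero _ _ i hi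
    have n3 := ht1 i
    have : t2 i = t1 i * ξ 1 2 i / ξ' 1 2 i := if_pos hi
    simp [t, this]
    field_simp
  have h02 : ∀ y, y ∈ cyclicSet Z (s 0 ∩ s 2) (ξ 0 2) ↔
      t 0 * (t 2)⁻¹ * y ∈ cyclicSet Z (s 0 ∩ s 2) (ξ' 0 2) := by
    refine mem_cyclicSet_iff_of_unit (hquot 0 2) r fun i hi ↦ ?_
    have n1 := h.gen_ne_zero _ _ i hi
    have n2 := h'.gen_ne_zero _ _ i hi
    by_cases hi1 : i ∈ s 1
    · have m1 := h.gen_ne_zero 0 1 i ⟨hi.1, hi1⟩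
      have m2 := h.gen_ne_zero 1 2 i ⟨hi1, hi.2⟩
      have m3 := h'.gen_ne_zero 0 1 i ⟨hi.1, hi1⟩
      have m4 := h'.gen_ne_zero 1 2 i ⟨hi1, hi.2⟩
      have e1 : t1 i = ξ 0 1 i / ξ' 0 1 i := if_pos ⟨hi.1, hi1⟩
      have e2 : t2 i = t1 i * ξ 1 2 i / ξ' 1 2 i := if_pos ⟨hi1, hi.2⟩
      obtain rfl := hi₀ i hi.1 hi1 hi.2
      simp [t, e1, e2]
      field_simp
      linear_combination hr
    · have e2 : t2 i = ξ 0 2 i / (algebraMap O K r * ξ' 0 2 i) := by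
        simp only [t2]
        rw [if_neg (fun hh ↦ hi1 hh.1), if_pos hi]
      simp [t, e2]
      field_simp
  have hself : ∀ j y, y ∈ cyclicSet Z (s j ∩ s j) (ξ j j) ↔
      t j * (t j)⁻¹ * y ∈ cyclicSet Z (s j ∩ s j) (ξ' j j) := by
    intro j
    refine mem_cyclicSet_iff_of_unit (hquot j j) 1 fun i hi ↦ ?_
    rw [h.gen_self j i hi.1, h'.gen_self j i hi.1]
    simp [mul_inv_cancel₀ (ht j i)]
  have hinv : ∀ j j', (t j * (t j')⁻¹)⁻¹ = t j' * (t j)⁻¹ := by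
    intro j j'
    rw [mul_inv, inv_inv, mul_comm]
  refine ⟨t, ht, fun j j' y ↦ ?_⟩
  have h10 := h.mem_iff_of_opposite h' (hquot 0 1) h01 y
  have h21 := h.mem_iff_of_opposite h' (hquot 1 2) h12 y
  have h20 := h.mem_iff_of_opposite h' (hquot 0 2) h02 y
  rw [hinv] at h10 h21 h20
  fin_cases j <;> fin_cases j'
  exacts [hself 0 y, h01 y, h02 y, h10, hself 1 y, h12 y, h20, h21, hself 2 y]

end PeirceData

end PeirceData

/-! ### Matrix coordinates adapted to orthogonal idempotents, and traces. -/

section Frames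

variable {K : Type*} [Field K] {ι : Type*} {d : ι → ℕ}

open Classical in
/-- A choice of coordinates for `⨁ i, K^{d i × d i}` which identifies the `i`-th component with the
matrices over `K` whose rows and columns are indexed by the `j : Fin 3` with `i ∈ s j`. -/
structure Frame (K : Type*) [Field K] {ι : Type*} (d : ι → ℕ) (s : Fin 3 → Set ι) where
  P : ∀ i, Matrix (Fin (d i)) (Fin 3) K
  Q : ∀ i, Matrix (Fin 3) (Fin (d i)) K
  P_mul_Q : ∀ i, P i * Q i = 1
  Q_mul_P : ∀ i, Q i * P i = Matrix.diagonal fun j ↦ if i ∈ s j then 1 else 0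

namespace Frame

variable {s : Fin 3 → Set ι} (F : Frame K d s)

/-- The coordinates of an element, as `3 × 3` matrices. -/
def coord (a : MatrixProd K d) (i : ι) : Matrix (Fin 3) (Fin 3) K := F.Q i * a i * F.P i

/-- The element with coordinates `y i` at position `(j, j')`. -/
def elem (j j' : Fin 3) (y : ι → K) : MatrixProd K d :=
  fun i ↦ F.P i * Matrix.single j j' (y i) * F.Q i

lemma P_mul_Q_mul {m : Type*} (i : ι) (M : Matrix (Fin (d i)) m K) :
    F.P i * (F.Q i * M) = M := by
  rw [← Matrix.mul_assoc, F.P_mul_Q, Matrix.one_mul]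

lemma diagonal_mul_coord_mul_diagonal (a : MatrixProd K d) (i : ι) :
    (F.Q i * F.P i) * F.coord a i * (F.Q i * F.P i) = F.coord a i := by
  simp only [coord, Matrix.mul_assoc, P_mul_Q_mul]

lemma coord_eq_zero {a : MatrixProd K d} {i : ι} {j j' : Fin 3} (h : i ∉ s j ∩ s j') :
    F.coord a i j j' = 0 := by
  rw [← F.diagonal_mul_coord_mul_diagonal, Q_mul_P, Matrix.mul_diagonal, Matrix.diagonal_mul]
  by_cases h1 : i ∈ s j
  · rw [if_neg fun h2 ↦ h ⟨h1, h2⟩, mul_zero]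
  · rw [if_neg h1, zero_mul, zero_mul]

lemma coord_mul (a b : MatrixProd K d) (i : ι) :
    F.coord (a * b) i = F.coord a i * F.coord b i := by
  simp only [coord, Pi.mul_apply, Matrix.mul_assoc, P_mul_Q_mul]

lemma coord_elem (j j' : Fin 3) (y : ι → K) (i : ι) :
    F.coord (F.elem j j' y) i =
      (F.Q i * F.P i) * Matrix.single j j' (y i) * (F.Q i * F.P i) := by
  simp only [coord, elem, Matrix.mul_assoc]

lemma coord_elem_apply {j j' : Fin 3} {y : ι → K} {i : ι} (h : i ∈ s j ∩ s j') :
    F.coord (F.elem j j' y) i j j' = y i := by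
  rw [coord_elem, Q_mul_P, Matrix.mul_diagonal, Matrix.diagonal_mul, if_pos h.1, if_pos h.2,
    Matrix.single_apply_same, one_mul, mul_one]

lemma coord_elem_apply_of_ne {j j' p q : Fin 3} {y : ι → K} {i : ι} (h : ¬(j = p ∧ j' = q)) :
    F.coord (F.elem j j' y) i p q = 0 := by
  rw [coord_elem, Q_mul_P, Matrix.mul_diagonal, Matrix.diagonal_mul,
    Matrix.single_apply_of_ne _ _ _ _ _ h, mul_zero, zero_mul]

lemma idem_mul_mul_idem (j j' : Fin 3) (a : MatrixProd K d) :
    F.elem j j 1 * a * F.elem j' j' 1 = F.elem j j' fun i ↦ F.coord a i j j' := by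
  funext i
  have := Matrix.single_mul_mul_single (n := Fin 3) j j j' j' (1 : K) (F.coord a i) (1 : K)
  simp only [elem, Pi.mul_apply, Pi.one_apply]
  rw [one_mul, mul_one] at this
  rw [← this, coord]
  simp only [Matrix.mul_assoc]

lemma sum_elem (a : MatrixProd K d) :
    ∑ j, ∑ j', F.elem j j' (fun i ↦ F.coord a i j j') = a := by
  funext i
  have : a i = F.P i * F.coord a i * F.Q i := by
    simp only [coord, Matrix.mul_assoc, P_mul_Q_mul, F.P_mul_Q, Matrix.mul_one]
  rw [this, Matrix.matrix_eq_sum_single (F.coord a i)]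
  simp only [Finset.sum_apply, elem, Matrix.mul_sum, Matrix.sum_mul]

lemma coord_injective : Function.Injective F.coord := fun a b h ↦ by
  rw [← F.sum_elem a, ← F.sum_elem b, h]

lemma elem_congr {j j' : Fin 3} {y y' : ι → K} (h : ∀ i ∈ s j ∩ s j', y i = y' i) :
    F.elem j j' y = F.elem j j' y' := by
  refine F.coord_injective (funext fun i ↦ ?_)
  by_cases hi : i ∈ s j ∩ s j'
  · rw [coord_elem, coord_elem, h i hi]
  · ext p q
    rw [coord_elem, coord_elem, Q_mul_P, Matrix.mul_diagonal, Matrix.diagonal_mul,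
      Matrix.mul_diagonal, Matrix.diagonal_mul, Matrix.single_apply, Matrix.single_apply]
    by_cases hpq : j = p ∧ j' = q
    · obtain ⟨rfl, rfl⟩ := hpq
      by_cases h1 : i ∈ s j
      · rw [if_neg fun h2 : i ∈ s j' ↦ hi ⟨h1, h2⟩, mul_zero, mul_zero]
      · rw [if_neg h1, zero_mul, zero_mul, zero_mul, zero_mul]
    · rw [if_neg hpq, if_neg hpq]

lemma elem_eq_iff {j j' : Fin 3} {y y' : ι → K} :
    F.elem j j' y = F.elem j j' y' ↔ ∀ i ∈ s j ∩ s j', y i = y' i :=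
  ⟨fun h i hi ↦ by rw [← F.coord_elem_apply (y := y) hi, h, F.coord_elem_apply hi], F.elem_congr⟩

lemma trace_elem_mul (j j' : Fin 3) (y : ι → K) (a : MatrixProd K d) (i : ι) :
    ((F.elem j' j y * a) i).trace = y i * F.coord a i j j' := by
  have : (F.elem j' j y * a) i = F.P i * (Matrix.single j' j (y i) * (F.Q i * a i)) := by
    simp only [elem, Pi.mul_apply, Matrix.mul_assoc]
  rw [this, Matrix.trace_mul_comm, Matrix.mul_assoc, ← coord, Matrix.trace,
    Finset.sum_eq_single j']
  · rw [Matrix.diag_apply, Matrix.single_mul_apply_same]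
  · intro p _ hp
    rw [Matrix.diag_apply, Matrix.single_mul_apply_of_ne _ _ _ _ _ hp]
  · simp

/-- The unit which transforms the frame `F` into the frame `F'`, rescaled by `t`. -/
def transition (F' : Frame K d s) (t : Fin 3 → ι → K) (ht : ∀ j i, t j i ≠ 0) :
    (MatrixProd K d)ˣ where
  val i := F'.P i * Matrix.diagonal (fun j ↦ t j i) * F.Q i
  inv i := F.P i * Matrix.diagonal (fun j ↦ (t j i)⁻¹) * F'.Q i
  val_inv := by
    funext i
    have : Matrix.diagonal (fun j ↦ t j i) * (F.Q i * F.P i * Matrix.diagonal fun j ↦ (t j i)⁻¹) =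
        F'.Q i * F'.P i := by
      rw [F.Q_mul_P, F'.Q_mul_P, Matrix.diagonal_mul_diagonal, Matrix.diagonal_mul_diagonal]
      congr 1
      funext j
      split_ifs <;> simp [ht j i]
    calc _ = F'.P i * (Matrix.diagonal (fun j ↦ t j i) *
          (F.Q i * F.P i * Matrix.diagonal fun j ↦ (t j i)⁻¹)) * F'.Q i := by
            simp only [Pi.mul_apply, Matrix.mul_assoc]
      _ = 1 := by rw [this]; simp only [P_mul_Q_mul, F'.P_mul_Q]
  inv_val := by
    funext i
    have : Matrix.diagonal (fun j ↦ (t j i)⁻¹) * (F'.Q i * F'.P i * Matrix.diagonal fun j ↦ t j i) =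
        F.Q i * F.P i := by
      rw [F.Q_mul_P, F'.Q_mul_P, Matrix.diagonal_mul_diagonal, Matrix.diagonal_mul_diagonal]
      congr 1
      funext j
      split_ifs <;> simp [ht j i]
    calc _ = F.P i * (Matrix.diagonal (fun j ↦ (t j i)⁻¹) *
          (F'.Q i * F'.P i * Matrix.diagonal fun j ↦ t j i)) * F.Q i := by
            simp only [Pi.mul_apply, Matrix.mul_assoc]
      _ = 1 := by rw [this]; simp only [P_mul_Q_mul, F.P_mul_Q]

/-- In coordinates the transition unit is the diagonal matrix with entries `t j i`; this turns a
rescaling of Peirce components into a conjugation. -/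
lemma coord_transition_conj (F' : Frame K d s) (t : Fin 3 → ι → K) (ht : ∀ j i, t j i ≠ 0)
    (a : MatrixProd K d) (i : ι) (j j' : Fin 3) :
    F'.coord ((F.transition F' t ht : MatrixProd K d) * a *
      ((F.transition F' t ht)⁻¹ : (MatrixProd K d)ˣ)) i j j' =
      t j i * (t j' i)⁻¹ * F.coord a i j j' := by
  by_cases h : i ∈ s j ∩ s j'
  · have : F'.coord ((F.transition F' t ht : MatrixProd K d) * a *
        ((F.transition F' t ht)⁻¹ : (MatrixProd K d)ˣ)) i =
        F'.Q i * F'.P i * (Matrix.diagonal (fun j ↦ t j i) * F.coord a i *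
          Matrix.diagonal (fun j ↦ (t j i)⁻¹)) * (F'.Q i * F'.P i) := by
      simp only [coord, transition, Units.inv_mk, Pi.mul_apply, Matrix.mul_assoc]
    rw [this, F'.Q_mul_P, Matrix.mul_diagonal, Matrix.diagonal_mul, Matrix.mul_diagonal,
      Matrix.diagonal_mul, if_pos h.1, if_pos h.2]
    ring
  · rw [F'.coord_eq_zero h, F.coord_eq_zero h, mul_zero]

end Frame

section Existence

variable [Fintype ι] [DecidableEq ι]

omit [Fintype ι] in
lemma single_smul_apply {D : ι → ℕ} (i : ι) (X : Matrix (Fin (d i)) (Fin (d i)) K)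
    (m : ∀ i, Fin (D i) → ColumnModule K d i) (p : Fin (D i)) :
    ((Pi.single i X : MatrixProd K d) • m) i p = X.mulVec (m i p) := by
  show ((Pi.single i X : MatrixProd K d) i).mulVec (m i p) = _
  rw [Pi.single_eq_same]

omit [Fintype ι] in
lemma single_smul_eq_zero {D : ι → ℕ} (i : ι) (X : Matrix (Fin (d i)) (Fin (d i)) K)
    (m : ∀ i, Fin (D i) → ColumnModule K d i) (h : ∀ p, X.mulVec (m i p) = 0) :
    (Pi.single i X : MatrixProd K d) • m = 0 := by
  funext i' p
  by_cases hi : i' = i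
  · subst hi
    rw [single_smul_apply, h]; rfl
  · show ((Pi.single i X : MatrixProd K d) i').mulVec (m i' p) = 0
    rw [Pi.single_eq_of_ne hi]
    exact Matrix.zero_mulVec _

omit [Fintype ι] in
/-- If the left ideal generated by an idempotent is multiplicity free, then the components of the
idempotent have rank at most one. -/
lemma exists_vecMulVec_eq (hd : ∀ i, 0 < d i) {D : ι → ℕ} {f : MatrixProd K d} (hf : f * f = f)
    (θ : Ideal.span {f} ≃ₗ[MatrixProd K d] (∀ i, Fin (D i) → ColumnModule K d i)) (i : ι)
    (hD : D i = 0 ∨ D i = 1) :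
    ∃ p q : Fin (d i) → K, f i = Matrix.vecMulVec p q ∧ (D i = 1 → q ⬝ᵥ p = 1) ∧
      (D i ≠ 1 → p = 0 ∧ q = 0) := by
  let f' : Ideal.span {f} := ⟨f, Ideal.mem_span_singleton_self f⟩
  have hff : f • f' = f' := Subtype.ext hf
  -- The generator `f'` and its image under `θ` have the same annihilator. With multiplicity one,
  -- the i-th part of the image is a single vector `w`, so what kills `w` kills `f i`.
  have kill : ∀ X : Matrix (Fin (d i)) (Fin (d i)) K, (∀ p, X.mulVec (θ f' i p) = 0) →
      X * f i = 0 := by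
    intro X hX
    have h1 : (Pi.single i X : MatrixProd K d) • f' = 0 := by
      apply θ.injective
      rw [map_smul, map_zero, single_smul_eq_zero i X _ hX]
    have h2 := congrFun (congrArg Subtype.val h1) i
    have h3 : ((Pi.single i X : MatrixProd K d) * f) i = 0 := h2
    rwa [Pi.mul_apply, Pi.single_eq_same] at h3
  rcases hD with h0 | h1
  · refine ⟨0, 0, ?_, fun h ↦ by omega, fun _ ↦ ⟨rfl, rfl⟩⟩
    have := kill 1 fun p ↦ (Fin.elim0 (h0 ▸ p))
    rw [Matrix.one_mul] at this
    rw [this, Matrix.zero_vecMulVec]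
  · let z : Fin (D i) := ⟨0, by omega⟩
    have hz : ∀ p : Fin (D i), p = z := fun p ↦ Fin.ext (by have := p.2; simp [z]; omega)
    let w : Fin (d i) → K := θ f' i z
    have hw : w ≠ 0 := by
      intro hw
      obtain ⟨g, hg⟩ := θ.surjective fun i' _ ↦ (fun _ ↦ 1 : Fin (d i') → K)
      obtain ⟨b, hb⟩ := Ideal.mem_span_singleton'.1 g.2
      have hgb : g = b • f' := Subtype.ext hb.symm
      rw [hgb, map_smul] at hg
      have h2 : (b i).mulVec w = fun _ ↦ 1 := congrFun (congrFun hg i) z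
      rw [hw, Matrix.mulVec_zero] at h2
      exact zero_ne_one (congrFun h2 ⟨0, hd i⟩)
    have hfw : (f i).mulVec w = w := by
      have := map_smul θ f f'
      rw [hff] at this
      exact (congrFun (congrFun this i) z).symm
    obtain ⟨l, hl⟩ := Function.ne_iff.1 hw
    rw [Pi.zero_apply] at hl
    let q₀ : Fin (d i) → K := Pi.single l (w l)⁻¹
    have hq₀ : q₀ ⬝ᵥ w = 1 := by simp [q₀, inv_mul_cancel₀ hl]
    -- The projection to the line of `w` fixes `w`, so its complement kills `f i`. Hence every
    -- column of `f i` is a multiple of `w`.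
    have hkill := kill (1 - Matrix.vecMulVec w q₀) (by
      intro p
      rw [hz p]
      change (1 - Matrix.vecMulVec w q₀).mulVec w = 0
      rw [Matrix.sub_mulVec, Matrix.one_mulVec, Matrix.vecMulVec_mulVec, hq₀]
      simp)
    rw [Matrix.sub_mul, Matrix.one_mul, sub_eq_zero, Matrix.vecMulVec_mul] at hkill
    refine ⟨w, Matrix.vecMul q₀ (f i), hkill, fun _ ↦ ?_, fun h ↦ absurd h1 h⟩
    rw [← Matrix.dotProduct_mulVec, hfw, hq₀]

omit [Fintype ι] in
/-- Orthogonal idempotents with multiplicity free left ideals define a frame. -/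
theorem exists_frame (hd : ∀ i, 0 < d i) {D : Matrix ι (Fin 3) ℕ} (hD : ∀ i j, D i j = 0 ∨ D i j = 1)
    {f : Fin 3 → MatrixProd K d} (hf : ∀ j, f j * f j = f j) (hne : ∀ j j', j ≠ j' → f j * f j' = 0)
    (hsum : ∑ j, f j = 1)
    (hθ : ∀ j, Nonempty (Ideal.span {f j} ≃ₗ[MatrixProd K d]
      (∀ i, Fin (D i j) → ColumnModule K d i))) :
    ∃ F : Frame K d (fun j ↦ {i | D i j = 1}), ∀ j, f j = F.elem j j 1 := by
  classical
  have key := fun i j ↦ exists_vecMulVec_eq hd (hf j) (hθ j).some i (hD i j)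
  choose p q hfpq hqp hpq0 using key
  let P : ∀ i, Matrix (Fin (d i)) (Fin 3) K := fun i ↦ Matrix.of fun k j ↦ p i j k
  let Q : ∀ i, Matrix (Fin 3) (Fin (d i)) K := fun i ↦ Matrix.of fun j k ↦ q i j k
  have hsingle : ∀ i j, f j i = P i * Matrix.single j j (1 : K) * Q i := by
    intro i j
    rw [hfpq]
    ext k l
    simp [P, Q, Matrix.mul_apply, Matrix.vecMulVec_apply, Matrix.single_apply, ite_and]
  have hQP : ∀ i j j', (Q i * P i) j j' = q i j ⬝ᵥ p i j' := fun i j j' ↦ rfl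
  refine ⟨⟨P, Q, ?_, ?_⟩, fun j ↦ funext fun i ↦ hsingle i j⟩
  · intro i
    have := congrFun hsum i
    rw [Finset.sum_apply] at this
    refine Eq.trans ?_ this
    simp only [hsingle, ← Matrix.sum_mul, ← Matrix.mul_sum]
    rw [Matrix.sum_single_one, Matrix.mul_one]
  · intro i
    ext j j'
    rw [hQP, Matrix.diagonal_apply]
    by_cases hj : D i j = 1
    · by_cases hj' : D i j' = 1
      · split_ifs with h1 h2
        · subst h1; exact hqp i j hj
        · exact absurd hj h2
        · have h0 := congrFun (hne j j' h1) i
          rw [Pi.mul_apply, hfpq, hfpq, Matrix.vecMulVec_mul_vecMulVec] at h0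
          have h2 := congrArg (fun M ↦ q i j ⬝ᵥ Matrix.mulVec M (p i j')) h0
          simpa [Matrix.vecMulVec_mulVec, hqp i j hj, hqp i j' hj', Matrix.smul_mulVec] using h2
      · rw [(hpq0 i j' hj').1, dotProduct_zero]
        split_ifs with h1 h2
        · subst h1; exact absurd hj hj'
        · rfl
        · rfl
    · rw [(hpq0 i j hj).2, zero_dotProduct]
      split_ifs with h1 h2
      · exact absurd h2 hj
      · rfl
      · rfl

/-- Tracial functionals on a split semisimple algebra are combinations of traces. -/
lemma exists_weights (hd : ∀ i, 0 < d i) (T : MatrixProd K d →ₗ[K] K)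
    (hT : ∀ x y, T (x * y) = T (y * x)) :
    ∃ u : ι → K, ∀ x, T x = ∑ i, u i * (x i).trace := by
  let g : ∀ i, Fin (d i) → Fin (d i) → K := fun i a b ↦
    T (Pi.single i (Matrix.single a b 1))
  have hmul : ∀ i (X Y : Matrix (Fin (d i)) (Fin (d i)) K),
      T (Pi.single i (X * Y)) = T (Pi.single i (Y * X)) := by
    intro i X Y
    rw [Pi.single_mul, Pi.single_mul, hT]
  -- An off-diagonal matrix unit is the commutator of E_aa and E_ab; below, two diagonal ones differ
  -- by the commutator of E_ab and E_ba.
  have hg0 : ∀ i a b, a ≠ b → g i a b = 0 := by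
    intro i a b hab
    have := hmul i (Matrix.single a a 1) (Matrix.single a b 1)
    rw [Matrix.single_mul_single_same, Matrix.single_mul_single_of_ne (h := hab.symm), Pi.single_zero,
      map_zero, one_mul] at this
    exact this
  have hg1 : ∀ i a b, g i a a = g i b b := by
    intro i a b
    have := hmul i (Matrix.single a b 1) (Matrix.single b a 1)
    rw [Matrix.single_mul_single_same, Matrix.single_mul_single_same, one_mul] at this
    exact this
  refine ⟨fun i ↦ g i ⟨0, hd i⟩ ⟨0, hd i⟩, fun x ↦ ?_⟩
  have hx : x = ∑ i, Pi.single i (x i) := by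
    funext i
    rw [Finset.sum_apply, Finset.sum_eq_single i]
    · rw [Pi.single_eq_same]
    · intro b _ hb; exact Pi.single_eq_of_ne hb.symm _
    · simp
  nth_rewrite 1 [hx]
  rw [map_sum]
  refine Finset.sum_congr rfl fun i _ ↦ ?_
  let Ti : Matrix (Fin (d i)) (Fin (d i)) K →ₗ[K] K :=
    T ∘ₗ LinearMap.single K (fun i ↦ Matrix (Fin (d i)) (Fin (d i)) K) i
  have hTi : ∀ a b (r : K), Ti (Matrix.single a b r) = r * g i a b := by
    intro a b r
    rw [← mul_one r, ← smul_eq_mul, ← Matrix.smul_single, map_smul, smul_eq_mul, smul_eq_mul, mul_one]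
    rfl
  show Ti (x i) = _
  conv_lhs => rw [Matrix.matrix_eq_sum_single (x i)]
  simp only [map_sum, hTi]
  rw [Matrix.trace, Finset.mul_sum]
  refine Finset.sum_congr rfl fun a _ ↦ ?_
  rw [Finset.sum_eq_single a]
  · rw [hg1 i a ⟨0, hd i⟩, Matrix.diag_apply, mul_comm]
  · intro b _ hb; rw [hg0 i a b hb.symm, mul_zero]
  · simp

omit [Fintype ι] in
/-- Central elements of a split semisimple algebra are scalar in each component. -/
lemma exists_scalar_of_commute {z : MatrixProd K d} (hz : ∀ a, a * z = z * a) :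
    ∃ ζ : ι → K, ∀ i, z i = Matrix.scalar _ (ζ i) := by
  have : ∀ i, ∃ r, Matrix.scalar _ r = z i := by
    intro i
    refine Matrix.mem_range_scalar_of_commute_single fun a b _ ↦ ?_
    have := congrFun (hz (Pi.single i (Matrix.single a b 1))) i
    rwa [Pi.mul_apply, Pi.mul_apply, Pi.single_eq_same] at this
  choose ζ hζ using this
  exact ⟨ζ, fun i ↦ (hζ i).symm⟩

end Existence

end Frames

/-! ### Extension of the symmetrizing form to the ambient algebra. -/

section Lattice

variable {O K : Type*} [CommRing O] [IsDomain O] [Field K] [Algebra O K] [IsFractionRing O K]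
variable {A : Type*} [Ring A] [Algebra O A] [Algebra K A] [IsScalarTower O K A]

/-- An element of the `K`-span of an `O`-submodule has a nonzero multiple in the submodule. -/
lemma exists_smul_mem_of_mem_span {M : Submodule O A} {x : A}
    (hx : x ∈ Submodule.span K (M : Set A)) : ∃ r : O, r ≠ 0 ∧ r • x ∈ M := by
  induction hx using Submodule.span_induction with
  | mem x hx => exact ⟨1, one_ne_zero, by rwa [one_smul]⟩
  | zero => exact ⟨1, one_ne_zero, by rw [smul_zero]; exact M.zero_mem⟩
  | add x y _ _ hx hy =>
    obtain ⟨r, hr, hx⟩ := hx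
    obtain ⟨t, ht, hy⟩ := hy
    refine ⟨r * t, mul_ne_zero hr ht, ?_⟩
    rw [smul_add, mul_comm, mul_smul, mul_comm, mul_smul]
    exact M.add_mem (M.smul_mem _ hx) (M.smul_mem _ hy)
  | smul a x _ hx =>
    obtain ⟨r, hr, hx⟩ := hx
    obtain ⟨n, t, ht, rfl⟩ := IsFractionRing.div_surjective (A := O) a
    have ht0 : t ≠ 0 := nonZeroDivisors.ne_zero ht
    have ht' : algebraMap O K t ≠ 0 := by simpa using ht0
    refine ⟨r * t, mul_ne_zero hr ht0, ?_⟩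
    have : (r * t) • (algebraMap O K n / algebraMap O K t) • x = n • r • x := by
      rw [← algebraMap_smul K (r * t), ← algebraMap_smul K n, ← algebraMap_smul K r, smul_smul,
        smul_smul, map_mul]
      congr 1
      field_simp
    rw [this]
    exact M.smul_mem _ hx

omit [IsDomain O] in
include K in
variable (K) in
lemma eq_zero_of_smul_eq_zero {r : O} (hr : r ≠ 0) {x : A} (h : r • x = 0) : x = 0 := by
  rw [← algebraMap_smul K r, smul_eq_zero] at h
  exact h.resolve_left (by simpa using hr)

/-- The symmetrizing form of a symmetric order extends to the algebra spanned by it,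
and recovers the order as its own dual. -/
theorem exists_tracial_form [IsPrincipalIdealRing O] {Λ : Subalgebra O A}
    (hΛ : Submodule.IsLattice K (Subalgebra.toSubmodule Λ)) (hsymm : IsSymmetricAlg O Λ) :
    ∃ T : A →ₗ[K] K, (∀ x y, T (x * y) = T (y * x)) ∧
      ∀ x, x ∈ Λ ↔ ∀ a ∈ Λ, T (x * a) ∈ (algebraMap O K).range := by
  obtain ⟨hfin, -, t, ht, hbij⟩ := hsymm
  have hfree : Module.Free O Λ := Submodule.IsLattice.free K (Subalgebra.toSubmodule Λ)
  let b : Module.Basis (Module.Free.ChooseBasisIndex O Λ) O (Subalgebra.toSubmodule Λ) :=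
    Module.Free.chooseBasis O Λ
  let bK := b.extendOfIsLattice K
  let T : A →ₗ[K] K := bK.constr K fun i ↦ algebraMap O K (t (b i))
  have hspan : ∀ x : A, x ∈ Submodule.span K (Λ : Set A) := by
    intro x
    have : Submodule.span K (Λ : Set A) = ⊤ := hΛ.span_eq_top
    rw [this]; trivial
  have hT : ∀ a : Λ, T a = algebraMap O K (t a) := by
    have : (T.restrictScalars O) ∘ₗ (Subalgebra.toSubmodule Λ).subtype =
        (Algebra.linearMap O K) ∘ₗ t := by
      refine b.ext fun i ↦ ?_
      show T (b i) = algebraMap O K (t (b i))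
      rw [← b.extendOfIsLattice_apply K i]
      exact bK.constr_basis K _ i
    exact fun a ↦ LinearMap.congr_fun this a
  clear_value T
  have hcomm : ∀ x y, T (x * y) = T (y * x) := by
    intro x y
    induction hspan x using Submodule.span_induction with
    | mem x hx =>
      induction hspan y using Submodule.span_induction with
      | mem y hy =>
        have h1 := hT (⟨x, hx⟩ * ⟨y, hy⟩)
        have h2 := hT (⟨y, hy⟩ * ⟨x, hx⟩)
        rw [ht, ← h2] at h1
        exact h1
      | zero => simp
      | add y z _ _ hy hz => rw [mul_add, add_mul, map_add, map_add, hy, hz]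
      | smul r y _ hy => rw [mul_smul_comm, smul_mul_assoc, map_smul, map_smul, hy]
    | zero => simp
    | add x z _ _ hx hz => rw [mul_add, add_mul, map_add, map_add, hx, hz]
    | smul r x _ hx => rw [mul_smul_comm, smul_mul_assoc, map_smul, map_smul, hx]
  have hinj : Function.Injective (algebraMap O K) := IsFractionRing.injective O K
  have hnondeg : ∀ x, (∀ a ∈ Λ, T (x * a) = 0) → x = 0 := by
    intro x hx
    obtain ⟨r, hr, hrx⟩ := exists_smul_mem_of_mem_span (M := Subalgebra.toSubmodule Λ) (hspan x)
    refine eq_zero_of_smul_eq_zero K hr ?_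
    have : (⟨r • x, hrx⟩ : Λ) = 0 := by
      refine hbij.1 (LinearMap.ext fun a ↦ ?_)
      show t (⟨r • x, hrx⟩ * a) = t (0 * a)
      apply hinj
      rw [zero_mul, map_zero, map_zero, ← hT]
      show T (r • x * a) = 0
      rw [← algebraMap_smul K r, smul_mul_assoc, map_smul, hx a a.2, smul_zero]
    exact congrArg Subtype.val this
  refine ⟨T, hcomm, fun x ↦ ⟨fun hx a ha ↦ ⟨_, (hT ⟨x * a, Λ.mul_mem hx ha⟩).symm⟩, fun hx ↦ ?_⟩⟩
  choose g hg using fun a : Λ ↦ hx a a.2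
  let G : Λ →ₗ[O] O :=
    { toFun := g
      map_add' := fun a a' ↦ hinj (by
        rw [map_add, hg, hg, hg, ← map_add, ← mul_add]; rfl)
      map_smul' := fun r a ↦ hinj (by
        rw [RingHom.id_apply, smul_eq_mul, map_mul, hg, hg]
        show T (x * (r • (a : A))) = _
        rw [mul_smul_comm, ← algebraMap_smul K r, map_smul, smul_eq_mul]) }
  obtain ⟨y, hy⟩ := hbij.2 G
  -- The integral functional `T (x * ·)` is represented by some `y` in `Λ`, and nondegeneracy over
  -- `K` identifies `x` with `y`.
  have : x - y = 0 := by
    refine hnondeg _ fun a ha ↦ ?_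
    have h1 : t (y * ⟨a, ha⟩) = g ⟨a, ha⟩ := LinearMap.congr_fun hy ⟨a, ha⟩
    rw [sub_mul, map_sub, ← hg ⟨a, ha⟩, ← h1, ← hT]
    exact sub_self _
  rw [sub_eq_zero.1 this]
  exact y.2

end Lattice

/-! ### From orders with a Peirce system to numerical Peirce data. -/

section Orders

variable {O K : Type*} [CommRing O] [IsDomain O] [IsDiscreteValuationRing O] [Field K] [Algebra O K]
  [IsFractionRing O K]
variable {ι : Type*} [Fintype ι] [DecidableEq ι] {d : ι → ℕ}
variable {Λ : Subalgebra O (MatrixProd K d)}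

variable (O K d) in
/-- The embedding of the centre. -/
def scalarHom : (ι → K) →ₐ[O] MatrixProd K d where
  toFun ζ i := algebraMap K _ (ζ i)
  map_one' := by funext i; simp
  map_mul' _ _ := by funext i; simp
  map_zero' := by funext i; simp
  map_add' _ _ := by funext i; simp
  commutes' r := by
    funext i
    exact (IsScalarTower.algebraMap_apply O K (Matrix (Fin (d i)) (Fin (d i)) K) r).symm

omit [IsDomain O] [IsDiscreteValuationRing O] [IsFractionRing O K] [Fintype ι] [DecidableEq ι] in
lemma scalarHom_mul_elem {s : Fin 3 → Set ι} (F : Frame K d s) (ζ y : ι → K) (j j' : Fin 3) :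
    scalarHom O K d ζ * F.elem j j' y = F.elem j j' (ζ * y) := by
  funext i
  show algebraMap K _ (ζ i) * (F.P i * Matrix.single j j' (y i) * F.Q i) =
    F.P i * Matrix.single j j' (ζ i * y i) * F.Q i
  rw [← Algebra.smul_def, ← smul_eq_mul (ζ i), ← Matrix.smul_single, Matrix.mul_smul,
    Matrix.smul_mul]

omit [IsDomain O] [IsDiscreteValuationRing O] [IsFractionRing O K] [Fintype ι] [DecidableEq ι] in
lemma smul_elem {s : Fin 3 → Set ι} (F : Frame K d s) (r : O) (y : ι → K) (j j' : Fin 3) :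
    r • F.elem j j' y = F.elem j j' fun i ↦ algebraMap O K r * y i := by
  have := scalarHom_mul_elem (O := O) F (algebraMap O (ι → K) r) y j j'
  rw [AlgHom.commutes, ← Algebra.smul_def] at this
  exact this

omit [IsDomain O] [IsDiscreteValuationRing O] [IsFractionRing O K] [Fintype ι] [DecidableEq ι] in
lemma commute_of_commute_lattice (hΛ : Submodule.IsLattice K (Subalgebra.toSubmodule Λ))
    {z : MatrixProd K d} (hz : ∀ a ∈ Λ, a * z = z * a) (a : MatrixProd K d) : a * z = z * a := by
  have ha : a ∈ Submodule.span K (Λ : Set (MatrixProd K d)) := by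
    have : Submodule.span K (Λ : Set (MatrixProd K d)) = ⊤ := hΛ.span_eq_top
    rw [this]; trivial
  induction ha using Submodule.span_induction with
  | mem a ha => exact hz a ha
  | zero => simp
  | add a b _ _ ha hb => rw [add_mul, mul_add, ha, hb]
  | smul r a _ ha => rw [smul_mul_assoc, mul_smul_comm, ha]

/-- The scalars in an order. -/
def scalarsOf (Λ : Subalgebra O (MatrixProd K d)) : Subalgebra O (ι → K) :=
  Λ.comap (scalarHom O K d)

/-- The coordinates of an order with a Peirce system form a system of Peirce data. -/
theorem exists_peirceData (hd : ∀ i, 0 < d i)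
    (hΛ : Submodule.IsLattice K (Subalgebra.toSubmodule Λ)) (hsymm : IsSymmetricAlg O Λ)
    {ϖ : O} (hϖ : Irreducible ϖ) {x : Fin 3 → Fin 3 → Λ} (hx : PeirceSystem Λ ϖ x)
    {s : Fin 3 → Set ι} (F : Frame K d s)
    (hF : ∀ j, (x j j : MatrixProd K d) = F.elem j j 1) :
    ∃ ξ u, PeirceData (scalarsOf Λ) s ϖ ξ u ∧
      ∀ j j' y, F.elem j j' y ∈ Λ ↔ y ∈ cyclicSet (scalarsOf Λ) (s j ∩ s j') (ξ j j') := by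
  obtain ⟨T, hT, hTΛ⟩ := exists_tracial_form hΛ hsymm
  obtain ⟨u, hu⟩ := exists_weights hd T hT
  let ξ : Fin 3 → Fin 3 → ι → K := fun j j' i ↦ F.coord (x j j') i j j'
  have hxelem : ∀ j j', (x j j' : MatrixProd K d) = F.elem j j' (ξ j j') := by
    intro j j'
    rw [← F.idem_mul_mul_idem, ← hF, ← hF]
    exact congrArg Subtype.val (by rw [hx.idem_mul, hx.mul_idem] : x j j' = x j j * x j j' * x j' j')
  have hpeirce : ∀ (a : MatrixProd K d), a ∈ Λ → ∀ j j',
      F.elem j j' (fun i ↦ F.coord a i j j') ∈ Λ := by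
    intro a ha j j'
    rw [← F.idem_mul_mul_idem, ← hF, ← hF]
    exact Λ.mul_mem (Λ.mul_mem (x j j).2 ha) (x j' j').2
  have hmem : ∀ j j' y, F.elem j j' y ∈ Λ ↔
      y ∈ cyclicSet (scalarsOf Λ) (s j ∩ s j') (ξ j j') := by
    intro j j' y
    constructor
    · intro hy
      obtain ⟨z, hz, hzy⟩ := hx.exists_center j j' ⟨_, hy⟩
      have hzc : ∀ a : MatrixProd K d, a * z = z * a := by
        refine commute_of_commute_lattice hΛ fun a ha ↦ ?_
        exact congrArg Subtype.val (Subalgebra.mem_center_iff.1 hz ⟨a, ha⟩)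
      obtain ⟨ζ, hζ⟩ := exists_scalar_of_commute hzc
      have hzs : (z : MatrixProd K d) = scalarHom O K d ζ := funext hζ
      refine ⟨ζ, ?_, ?_⟩
      · show scalarHom O K d ζ ∈ Λ
        rw [← hzs]; exact z.2
      · have h1 : (x j j : MatrixProd K d) * F.elem j j' y * x j' j' = z * x j j' :=
          congrArg Subtype.val hzy
        rw [hF, hF, F.idem_mul_mul_idem, hzs, hxelem, scalarHom_mul_elem, F.elem_eq_iff] at h1
        intro i hi
        have := h1 i hi
        rwa [F.coord_elem_apply hi] at this
    · rintro ⟨ζ, hζ, hy⟩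
      rw [F.elem_congr (y' := ζ * ξ j j') hy, ← scalarHom_mul_elem (O := O), ← hxelem]
      exact Λ.mul_mem hζ (x j j').2
  have hpair : ∀ j j' (y : ι → K) (a : MatrixProd K d), T (F.elem j' j y * a) =
      weightedPairing u (s j ∩ s j') (fun i ↦ F.coord a i j j') y := by
    intro j j' y a
    rw [hu]
    refine Finset.sum_congr rfl fun i _ ↦ ?_
    rw [F.trace_elem_mul]
    split_ifs with hi
    · ring
    · rw [F.coord_eq_zero hi]; ring
  -- `Λ` spans the algebra, so a nonzero multiple of `F.elem j j' 1` lies in `Λ`; a zero coordinate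
  -- of the generator would contradict this.
  have hne0 : ∀ j j', ∀ i ∈ s j ∩ s j', ξ j j' i ≠ 0 := by
    intro j j' i hi h0
    have hspan : Submodule.span K (Λ : Set (MatrixProd K d)) = ⊤ := hΛ.span_eq_top
    obtain ⟨r, hr, hmemr⟩ := exists_smul_mem_of_mem_span (K := K) (M := Subalgebra.toSubmodule Λ)
      (x := F.elem j j' 1) (by
        show _ ∈ Submodule.span K (Λ : Set (MatrixProd K d))
        rw [hspan]; trivial)
    rw [smul_elem] at hmemr
    obtain ⟨ζ, -, hζ⟩ := (hmem j j' _).1 hmemr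
    have := hζ i hi
    simp only [h0, mul_zero, Pi.one_apply, mul_one] at this
    exact hr ((map_eq_zero_iff _ (IsFractionRing.injective O K)).1 this)
  have hprod : ∀ i, F.coord (x 0 1 * x 1 2 : MatrixProd K d) i 0 2 = ξ 0 1 i * ξ 1 2 i := by
    intro i
    rw [F.coord_mul, Matrix.mul_apply, Finset.sum_eq_single 1]
    · intro p _ hp
      rw [hxelem 0 1, F.coord_elem_apply_of_ne fun h ↦ hp h.2.symm, zero_mul]
    · simp
  refine ⟨ξ, u, ⟨?_, ?_, ?_, ?_, ?_, ?_⟩, hmem⟩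
  · intro j i hi
    show F.coord (x j j) i j j = 1
    rw [hF, F.coord_elem_apply ⟨hi, hi⟩, Pi.one_apply]
  · exact hne0
  -- With weight zero, the form ignores the i-th component, so self-duality puts all scalars of that
  -- copy of `K` into `Λ`. A finitely generated module contains no nonzero element divisible by
  -- every power of `ϖ`.
  · intro i h0
    have hall : ∀ r : K, (Pi.single i (algebraMap K _ r) : MatrixProd K d) ∈ Λ := by
      intro r
      rw [hTΛ]
      intro a _
      rw [hu, Finset.sum_eq_zero]
      · exact zero_mem _
      · intro i' _
        by_cases hi : i' = i
        · subst hi; rw [h0, zero_mul]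
        · rw [Pi.mul_apply, Pi.single_eq_of_ne hi, zero_mul, Matrix.trace_zero, mul_zero]
    have : Module.Finite O Λ := hsymm.1
    have hzero : (⟨_, hall 1⟩ : Λ) = 0 := by
      refine eq_zero_of_forall_exists_eq_pow_smul hϖ fun n ↦ ⟨⟨_, hall (algebraMap O K ϖ ^ n)⁻¹⟩, ?_⟩
      refine Subtype.ext ?_
      show (Pi.single i (algebraMap K _ 1) : MatrixProd K d) =
        ϖ ^ n • Pi.single i (algebraMap K _ (algebraMap O K ϖ ^ n)⁻¹)
      have hne : algebraMap O K ϖ ^ n ≠ 0 := pow_ne_zero _ (by simpa using hϖ.ne_zero)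
      rw [← Pi.single_smul, ← algebraMap_smul K (ϖ ^ n), Algebra.smul_def, ← map_mul, map_pow,
        mul_inv_cancel₀ hne]
    have h2 := congrFun (congrArg Subtype.val hzero) i
    change (Pi.single i (algebraMap K _ 1) : MatrixProd K d) i = 0 at h2
    rw [Pi.single_eq_same, map_one] at h2
    have h3 := congrFun (congrFun h2 ⟨0, hd i⟩) ⟨0, hd i⟩
    rw [Matrix.one_apply_eq, Matrix.zero_apply] at h3
    exact one_ne_zero h3
  · intro j j' y
    rw [← hmem, hTΛ]
    constructor
    · intro h v hv
      have := h _ ((hmem j j' v).2 hv)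
      rw [hpair] at this
      convert this using 1
      refine PeirceData.weightedPairing_congr fun i hi ↦ ?_
      rw [F.coord_elem_apply hi]
    · intro h a ha
      rw [hpair]
      exact h _ ((hmem j j' _).1 (hpeirce a ha j j'))
  · obtain ⟨ζ, hζ, h1⟩ := (hmem 0 2 _).1 (hpeirce _ (Λ.mul_mem (x 0 1).2 (x 1 2).2) 0 2)
    simp only [hprod] at h1
    refine ⟨ζ, hζ, fun i hi _ ↦ h1 i hi, fun i hi hi1 ↦ ?_⟩
    have h2 : ξ 0 1 i = 0 := F.coord_eq_zero fun h ↦ hi1 h.2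
    have h3 := h1 i hi
    rw [h2, zero_mul] at h3
    exact (mul_eq_zero.1 h3.symm).resolve_right (hne0 0 2 i hi)
  · intro ζ hζ h1 h2
    have hmem2 : F.elem 0 2 (ζ * ξ 0 2) ∈ Λ := (hmem 0 2 _).2 ⟨ζ, hζ, fun i _ ↦ rfl⟩
    refine hx.mul_ne_smul 0 1 2 (by decide) (by decide) (by decide) ⟨_, hmem2⟩ (Subtype.ext ?_)
    have h3 : x 0 1 * x 1 2 = x 0 0 * (x 0 1 * x 1 2) * x 2 2 := by
      rw [mul_assoc, mul_assoc, hx.mul_idem, ← mul_assoc, hx.idem_mul]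
    show ((x 0 1 * x 1 2 : Λ) : MatrixProd K d) = ϖ • F.elem 0 2 (ζ * ξ 0 2)
    rw [h3]
    show (x 0 0 : MatrixProd K d) * (x 0 1 * x 1 2) * x 2 2 = _
    rw [hF, hF, F.idem_mul_mul_idem, smul_elem, F.elem_eq_iff]
    intro i hi
    rw [hprod]
    by_cases hi1 : i ∈ s 1
    · exact h1 i hi hi1
    · have h4 : ξ 0 1 i = 0 := F.coord_eq_zero fun h ↦ hi1 h.2
      rw [h4, Pi.mul_apply, h2 i hi hi1]
      simp

end Orders

/-! ### The residue algebra as a reduction; scalar extension of projectives. -/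

section Reduction

open IsLocalRing

variable {O : Type*} [CommRing O] [IsDomain O] [IsDiscreteValuationRing O] {ϖ : O}
variable {S : Type*} [Ring S] [Algebra O S]

/-- An isomorphism from `k ⊗ S` to `B` makes `B` the reduction of `S`. -/
lemma isReduction_of_algEquiv {B : Type*} [Ring B] [Algebra (ResidueField O) B]
    (hϖ : Irreducible ϖ) (φ : (ResidueField O ⊗[O] S) ≃ₐ[ResidueField O] B) :
    IsReduction ϖ ((φ : (ResidueField O ⊗[O] S) →+* B).comp
      (Algebra.TensorProduct.includeRight : S →ₐ[O] ResidueField O ⊗[O] S).toRingHom) := by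
  have hsmul : ∀ (r : O) (s : S), (1 : ResidueField O) ⊗ₜ[O] (r • s) =
      residue O r • ((1 : ResidueField O) ⊗ₜ[O] s) := by
    intro r s
    rw [TensorProduct.tmul_smul]
    exact (algebraMap_smul (ResidueField O) r _).symm
  refine ⟨hϖ, ?_, ?_, ?_⟩
  · intro b
    obtain ⟨a, rfl⟩ := φ.surjective b
    induction a using TensorProduct.induction_on with
    | zero => exact ⟨0, by simp⟩
    | tmul r s =>
      obtain ⟨r, rfl⟩ := residue_surjective r
      refine ⟨r • s, ?_⟩
      show φ (1 ⊗ₜ (r • s)) = _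
      rw [hsmul, TensorProduct.smul_tmul', smul_eq_mul, mul_one]
    | add a b ha hb =>
      obtain ⟨s, hs⟩ := ha
      obtain ⟨t, ht⟩ := hb
      exact ⟨s + t, by rw [map_add, map_add, hs, ht]⟩
  · intro r s
    show φ (1 ⊗ₜ (r • s)) = _ • φ (1 ⊗ₜ s)
    rw [hsmul, map_smul]
  · intro s hs
    have h1 : (1 : ResidueField O) ⊗ₜ[O] s = 0 := φ.injective (hs.trans (map_zero φ).symm)
    rw [← mem_maximalIdeal_smul_top_iff hϖ, ← Submodule.Quotient.mk_eq_zero,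
      ← TensorProduct.quotTensorEquivQuotSMul_mk_one_tmul]
    exact (congrArg (TensorProduct.quotTensorEquivQuotSMul S (maximalIdeal O)) h1).trans
      (map_zero _)

end Reduction

/-- Left ideals generated by idempotents of a subring stay isomorphic in the ring. -/
lemma nonempty_span_equiv_of_subalgebra {O A : Type*} [CommRing O] [Ring A] [Algebra O A]
    {Λ : Subalgebra O A} {e f : Λ} (he : e * e = e) (hf : f * f = f)
    (h : Nonempty (Ideal.span {e} ≃ₗ[Λ] Ideal.span {f})) :
    Nonempty (Ideal.span {(e : A)} ≃ₗ[A] Ideal.span {(f : A)}) := by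
  obtain ⟨θ⟩ := h
  obtain ⟨p, q, hp1, hp2, hq1, hq2, hpq, hqp⟩ := exists_mul_eq_of_span_equiv he hf θ
  have mem : ∀ {g x : A}, g * g = g → x ∈ Ideal.span {g} → x * g = x := by
    intro g x hg hx
    obtain ⟨a, rfl⟩ := Ideal.mem_span_singleton'.1 hx
    rw [mul_assoc, hg]
  have coe : ∀ {a b c : Λ}, a * b = c → (a : A) * b = c := fun h ↦ congrArg Subtype.val h
  exact ⟨LinearEquiv.ofLinearMap
    ((LinearMap.toSpanSingleton A A (p : A)).restrict fun a _ ↦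
      Ideal.mem_span_singleton'.2 ⟨a * p, by
        show _ = a * (p : A)
        rw [mul_assoc, coe hp2]⟩)
    ((LinearMap.toSpanSingleton A A (q : A)).restrict fun a _ ↦
      Ideal.mem_span_singleton'.2 ⟨a * q, by
        show _ = a * (q : A)
        rw [mul_assoc, coe hq2]⟩)
    (by
      refine LinearMap.ext fun a ↦ Subtype.ext ?_
      show (a : A) * q * p = a
      rw [mul_assoc, coe hqp, mem (coe hf) a.2])
    (by
      refine LinearMap.ext fun a ↦ Subtype.ext ?_
      show (a : A) * p * q = a
      rw [mul_assoc, coe hpq, mem (coe he) a.2])⟩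

/-! ### Coordinates for the given orders and their conjugacy. -/

section Orders

open IsLocalRing

variable {O K : Type*} [CommRing O] [IsDomain O] [IsDiscreteValuationRing O] [Field K] [Algebra O K]
  [IsFractionRing O K]
variable {ι : Type*} [Fintype ι] [DecidableEq ι] {d : ι → ℕ}
variable {Λ : Subalgebra O (MatrixProd K d)}

/-- The characters of the simple modules, restricted to an order. -/
def latticeCharacter (Λ : Subalgebra O (MatrixProd K d)) : Λ →ₗ[O] (ι → K) where
  toFun a i := (a : MatrixProd K d) i |>.trace
  map_add' _ _ := funext fun _ ↦ Matrix.trace_add _ _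
  map_smul' r a := funext fun i ↦ Matrix.trace_smul r ((a : MatrixProd K d) i)

omit [IsDomain O] [IsDiscreteValuationRing O] [IsFractionRing O K] [Fintype ι] [DecidableEq ι] in
lemma latticeCharacter_mul_comm (a b : Λ) :
    latticeCharacter Λ (a * b) = latticeCharacter Λ (b * a) :=
  funext fun i ↦ Matrix.trace_mul_comm ((a : MatrixProd K d) i) ((b : MatrixProd K d) i)

omit [IsDomain O] [IsDiscreteValuationRing O] [IsFractionRing O K] [Fintype ι] [DecidableEq ι] in
-- The tuple of traces maps the algebra onto K^ι, and the order spans the algebra. This is the rank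
-- input for freeness of the cocentre.
lemma span_range_latticeCharacter (hd : ∀ i, 0 < d i)
    (hΛ : Submodule.IsLattice K (Subalgebra.toSubmodule Λ)) :
    Submodule.span K (Set.range (latticeCharacter Λ)) = ⊤ := by
  let τ : MatrixProd K d →ₗ[K] (ι → K) :=
    LinearMap.pi fun i ↦ (Matrix.traceLinearMap (Fin (d i)) K K).comp (LinearMap.proj i)
  have hτ : Function.Surjective τ := by
    intro y
    refine ⟨fun i ↦ Matrix.single ⟨0, hd i⟩ ⟨0, hd i⟩ (y i), funext fun i ↦ ?_⟩
    exact Matrix.trace_single_eq_same (⟨0, hd i⟩ : Fin (d i)) (y i)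
  have hrange : Set.range (latticeCharacter Λ) = τ '' (Λ : Set (MatrixProd K d)) := by
    ext y
    constructor
    · rintro ⟨a, rfl⟩
      exact ⟨a, a.2, rfl⟩
    · rintro ⟨a, ha, rfl⟩
      exact ⟨⟨a, ha⟩, rfl⟩
  have hspan : Submodule.span K (Λ : Set (MatrixProd K d)) = ⊤ := hΛ.span_eq_top
  rw [hrange, Submodule.span_image, hspan, Submodule.map_top, LinearMap.range_eq_top.2 hτ]

/-- Coordinates for an order which reduces to `Q(3K)^c`. -/
theorem exists_frame_peirceData [IsAdicComplete (maximalIdeal O) O] {c : ℕ} (hc : 2 ≤ c)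
    (hcard : Fintype.card ι = c + 5) (hd : ∀ i, 0 < d i) {D : Matrix ι (Fin 3) ℕ}
    (hD : ∀ i j, D i j = 0 ∨ D i j = 1) {ϖ : O} (hϖ : Irreducible ϖ)
    (hΛ : Submodule.IsLattice K (Subalgebra.toSubmodule Λ)) (hsymm : IsSymmetricAlg O Λ)
    (hred : Nonempty ((ResidueField O ⊗[O] Λ) ≃ₐ[ResidueField O] Q3K (ResidueField O) c))
    (hdecomp : HasDecompositionMatrix d Λ D) :
    ∃ (F : Frame K d fun j ↦ {i | D i j = 1}) (ξ : Fin 3 → Fin 3 → ι → K) (u : ι → K),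
      PeirceData (scalarsOf Λ) (fun j ↦ {i | D i j = 1}) ϖ ξ u ∧ (∀ j, F.elem j j 1 ∈ Λ) ∧
      ∀ j j' y, F.elem j j' y ∈ Λ ↔
        y ∈ cyclicSet (scalarsOf Λ) ({i | D i j = 1} ∩ {i | D i j' = 1}) (ξ j j') := by
  obtain ⟨φ⟩ := hred
  have hfin : Module.Finite O Λ := hsymm.1
  have hfree : Module.Free O Λ := Submodule.IsLattice.free K (Subalgebra.toSubmodule Λ)
  obtain ⟨x₀, hx₀⟩ := (isReduction_of_algEquiv hϖ φ).exists_peirceSystem hc hcard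
    (latticeCharacter Λ) latticeCharacter_mul_comm (span_range_latticeCharacter hd hΛ) hsymm
  obtain ⟨e, hprim, -, hex, hθ⟩ := hdecomp
  -- The lifted vertices need not be labelled like the columns of `D`. Matching isomorphism classes
  -- gives an injection between three-element sets, hence a permutation along which the Peirce
  -- system is relabelled.
  choose σ hσ using fun v ↦ hex (x₀ v v) (hx₀.primitive v)
  have hinj : Function.Injective σ := by
    intro u v huv
    have hv := hσ v
    rw [← huv] at hv
    exact hx₀.eq_of_equiv u v ⟨(hσ u).some.trans hv.some.symm⟩
  let τ : Fin 3 ≃ Fin 3 := Equiv.ofBijective σ (Finite.injective_iff_bijective.1 hinj)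
  have hx := hx₀.reindex τ.symm
  have hiso : ∀ j, Nonempty (Ideal.span {x₀ (τ.symm j) (τ.symm j)} ≃ₗ[Λ] Ideal.span {e j}) := by
    intro j
    have h1 := hσ (τ.symm j)
    rwa [show σ (τ.symm j) = j from τ.apply_symm_apply j] at h1
  generalize hxd : (fun u v ↦ x₀ (τ.symm u) (τ.symm v)) = x at hx
  obtain ⟨F, hF⟩ := exists_frame (f := fun j ↦ (x j j : MatrixProd K d)) hd hD
    (fun j ↦ congrArg Subtype.val (hx.primitive j).1.eq)
    (fun j j' h ↦ congrArg Subtype.val (hx.idem_mul_idem_of_ne j j' h))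
    (by
      have h1 := congrArg Λ.val hx.sum_idem
      rwa [map_sum, map_one] at h1)
    (fun j ↦ by
      have h1 := hiso j
      rw [show x₀ (τ.symm j) (τ.symm j) = x j j by rw [← hxd]] at h1
      obtain ⟨θ⟩ := nonempty_span_equiv_of_subalgebra (hx.primitive j).1.eq (hprim j).1.eq h1
      exact ⟨θ.trans (hθ j).some⟩)
  obtain ⟨ξ, u, hdata, hmem⟩ := exists_peirceData hd hΛ hsymm hϖ hx F hF
  exact ⟨F, ξ, u, hdata, fun j ↦ by rw [← hF]; exact (x j j).2, hmem⟩

omit [IsDomain O] [IsDiscreteValuationRing O] [IsFractionRing O K] [Fintype ι] [DecidableEq ι] in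
lemma mem_iff_forall_elem_mem {s : Fin 3 → Set ι} (F : Frame K d s) (hF : ∀ j, F.elem j j 1 ∈ Λ)
    (a : MatrixProd K d) : a ∈ Λ ↔ ∀ j j', F.elem j j' (fun i ↦ F.coord a i j j') ∈ Λ := by
  constructor
  · intro ha j j'
    rw [← F.idem_mul_mul_idem]
    exact Λ.mul_mem (Λ.mul_mem (hF j) ha) (hF j')
  · intro h
    rw [← F.sum_elem a]
    exact Λ.sum_mem fun j _ ↦ Λ.sum_mem fun j' _ ↦ h j j'

omit [IsDomain O] [IsDiscreteValuationRing O] [IsFractionRing O K] [Fintype ι] [DecidableEq ι] in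
lemma mem_scalarsOf_iff {ζ : ι → K} : ζ ∈ scalarsOf Λ ↔
    scalarHom O K d ζ ∈ {x : MatrixProd K d | x ∈ Λ ∧ ∀ y ∈ Λ, x * y = y * x} :=
  ⟨fun h ↦ ⟨h, fun y _ ↦ funext fun i ↦ Algebra.commutes (ζ i) (y i)⟩, fun h ↦ h.1⟩

/-- Symmetric orders which reduce to `Q(3K)^c` are determined up to conjugation by their centre
and their decomposition matrix if exactly one row of the matrix is `(1, 1, 1)`. -/
theorem exists_conj_of_center_eq [IsAdicComplete (maximalIdeal O) O] {c : ℕ} (hc : 2 ≤ c)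
    (hcard : Fintype.card ι = c + 5) (hd : ∀ i, 0 < d i) {D : Matrix ι (Fin 3) ℕ}
    (hD : ∀ i j, D i j = 0 ∨ D i j = 1) {i₀ : ι} (hi₀ : ∀ i, (∀ j, D i j = 1) ↔ i = i₀)
    {Λ Γ : Subalgebra O (MatrixProd K d)}
    (hΛ : Submodule.IsLattice K (Subalgebra.toSubmodule Λ))
    (hΓ : Submodule.IsLattice K (Subalgebra.toSubmodule Γ))
    (hΛ_red : Nonempty ((ResidueField O ⊗[O] Λ) ≃ₐ[ResidueField O] Q3K (ResidueField O) c))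
    (hΓ_red : Nonempty ((ResidueField O ⊗[O] Γ) ≃ₐ[ResidueField O] Q3K (ResidueField O) c))
    (hΛ_symm : IsSymmetricAlg O Λ) (hΓ_symm : IsSymmetricAlg O Γ)
    (hΛ_decomp : HasDecompositionMatrix d Λ D) (hΓ_decomp : HasDecompositionMatrix d Γ D)
    (hcenter : {x : MatrixProd K d | x ∈ Λ ∧ ∀ y ∈ Λ, x * y = y * x} =
      {x : MatrixProd K d | x ∈ Γ ∧ ∀ y ∈ Γ, x * y = y * x}) :
    ∃ u : (MatrixProd K d)ˣ, ∀ a : MatrixProd K d, a ∈ Λ ↔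
      (u : MatrixProd K d) * a * (↑u⁻¹ : MatrixProd K d) ∈ Γ := by
  obtain ⟨ϖ, hϖ⟩ := IsDiscreteValuationRing.exists_irreducible O
  obtain ⟨F, ξ, u, hdata, hF, hmem⟩ :=
    exists_frame_peirceData hc hcard hd hD hϖ hΛ hΛ_symm hΛ_red hΛ_decomp
  obtain ⟨F', ξ', u', hdata', hF', hmem'⟩ :=
    exists_frame_peirceData hc hcard hd hD hϖ hΓ hΓ_symm hΓ_red hΓ_decomp
  have hZ : scalarsOf Λ = scalarsOf Γ := by
    ext ζ
    rw [mem_scalarsOf_iff, mem_scalarsOf_iff, hcenter]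
  rw [hZ] at hdata hmem
  obtain ⟨t, ht, hiff⟩ := hdata.exists_rescaling hϖ hdata' (i₀ := i₀)
    (fun i h0 h1 h2 ↦ (hi₀ i).1 (Fin.forall_fin_succ.2 ⟨h0, Fin.forall_fin_two.2 ⟨h1, h2⟩⟩))
    (have h := (hi₀ i₀).2 rfl; ⟨h 0, h 1, h 2⟩)
  refine ⟨F.transition F' t ht, fun a ↦ ?_⟩
  rw [mem_iff_forall_elem_mem F hF, mem_iff_forall_elem_mem F' hF']
  refine forall_congr' fun j ↦ forall_congr' fun j' ↦ ?_
  rw [hmem, hmem', hiff]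
  simp only [F.coord_transition_conj]
  rfl

end Orders

lemma decompositionRow_eq_zero_or_one (i : ℕ) (j : Fin 3) :
    decompositionRow i j = 0 ∨ decompositionRow i j = 1 := by
  unfold decompositionRow
  split <;> fin_cases j <;> simp

lemma forall_decompositionRow_eq_one_iff (i : ℕ) :
    (∀ j, decompositionRow i j = 1) ↔ i = 3 := by
  unfold decompositionRow
  split <;> simp_all [Fin.forall_fin_succ]

theorem theorem4p2 {O K : Type*} [CommRing O] [IsDomain O] [IsDiscreteValuationRing O]
    [IsAdicComplete (IsLocalRing.maximalIdeal O) O] [CharZero O]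
    [CharP (IsLocalRing.ResidueField O) 2] [IsAlgClosed (IsLocalRing.ResidueField O)]
    [Field K] [Algebra O K] [IsFractionRing O K]
    (n : ℕ) (hn : 3 ≤ n)
    (Λ Γ : Subalgebra O (MatrixProd K (sizes n)))
    (hΛ_order : Submodule.IsLattice K (Subalgebra.toSubmodule Λ))
    (hΓ_order : Submodule.IsLattice K (Subalgebra.toSubmodule Γ))
    (hΛ_red : Nonempty ((IsLocalRing.ResidueField O ⊗[O] Λ) ≃ₐ[IsLocalRing.ResidueField O]
      Q3K (IsLocalRing.ResidueField O) (2 ^ (n - 2))))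
    (hΓ_red : Nonempty ((IsLocalRing.ResidueField O ⊗[O] Γ) ≃ₐ[IsLocalRing.ResidueField O]
      Q3K (IsLocalRing.ResidueField O) (2 ^ (n - 2))))
    (hΛ_symm : IsSymmetricAlg O Λ) (hΓ_symm : IsSymmetricAlg O Γ)
    (hΛ_decomp : HasDecompositionMatrix (sizes n) Λ (decompositionMatrix n))
    (hΓ_decomp : HasDecompositionMatrix (sizes n) Γ (decompositionMatrix n))
    (h_center : {x : MatrixProd K (sizes n) | x ∈ Λ ∧ ∀ y ∈ Λ, x * y = y * x} =
      {x : MatrixProd K (sizes n) | x ∈ Γ ∧ ∀ y ∈ Γ, x * y = y * x}) :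
    ∃ u : (MatrixProd K (sizes n))ˣ,
      (Γ : Set (MatrixProd K (sizes n))) = (fun x : MatrixProd K (sizes n) ↦ (u : MatrixProd K (sizes n)) * x * (↑u⁻¹ : MatrixProd K (sizes n))) '' (Λ : Set (MatrixProd K (sizes n))) := by
  have hc : 2 ≤ 2 ^ (n - 2) := Nat.le_pow (show 0 < n - 2 by omega)
  -- The number of components is 6 + (c - 1) = c + 5, as the rank count needs, and index 3 carries
  -- the only row (1,1,1).
  obtain ⟨u, hu⟩ := exists_conj_of_center_eq (d := sizes n) (D := decompositionMatrix n)
    (i₀ := ⟨3, by omega⟩) hc (by rw [Fintype.card_fin]; omega)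
    (fun i ↦ by
      show 0 < componentSize i
      unfold componentSize
      split <;> decide)
    (fun i j ↦ decompositionRow_eq_zero_or_one i j)
    (fun i ↦ by rw [Fin.ext_iff]; exact forall_decompositionRow_eq_one_iff i)
    hΛ_order hΓ_order hΛ_red hΓ_red hΛ_symm hΓ_symm hΛ_decomp hΓ_decomp h_center
  refine ⟨u, Set.ext fun y ↦ ⟨fun hy ↦ ⟨↑u⁻¹ * y * u, (hu _).2 ?_, ?_⟩, ?_⟩⟩
  · simpa [mul_assoc] using hy
  · simp [mul_assoc]
  · rintro ⟨a, ha, rfl⟩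
    exact (hu a).1 ha
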